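/- Let $n,m,p,q$ be integers with $m\ge 1$, and consider the matched control-affine system $$\dot y = f(y)+\sum_{i=1}^m g_i(y)\bigl(b_iu_i+\varphi_i'(y)\theta+A_i'(y)d\bigr),\qquad y\in\mathbb R^n,$$ where $f,g_i:\mathbb R^n\to\mathbb R^n$, $\varphi_i:\mathbb R^n\to\mathbb R^p$, $A_i:\mathbb R^n\to\mathbb R^q$ are smooth, $f(0)=0$ and $\varphi_i(0)=0$ for $i=1,\dots,m$. Here $u_i\in\mathbb R$ are the controls and $d(t)\in\mathbb R^q$, $\theta(t)\in\mathbb R^p$, $b(t)\in(0,\infty)^m$ are unknown and time-varying. Write $|\cdot|$ for the Euclidean norm, $\|\cdot\|_\infty$ for the essential supremum norm on $\mathbb R_+=[0,\infty)$, $x^+=\max(x,0)$, and $\nabla V$ for the gradient as a row vector. Suppose that the following hold. (A) There are $\sigma\in\mathbb R$ and smooth $V,Q,s_i:\mathbb R^n\to\mathbb R_+$, $\delta_i:\mathbb R^n\to\mathbb R$, where $V$ and $Q$ are positive definite and radially unbounded (every set $\{V\le M\}$, $\{Q\le M\}$ with $M>0$ is compact), such that for all $y\in\mathbb R^n$ $$\nabla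 V(y)f(y)\le -Q(y)+\sigma\sum_{i=1}^m\delta_i(y)\nabla V(y)g_i(y)+\sum_{i=1}^m s_i(y)\bigl(\nabla V(y)g_i(y)\bigr)^2 .$$ (B) There are a smooth $\mu:\mathbb R^n\to(0,\infty)$ and $\Lambda\ge 0$ such that $\sum_{i=1}^m|\varphi_i(y)|^2\le\mu(y)(Q(y)+\Lambda)$ for all $y\in\mathbb R^n$. Let $\varepsilon,\Gamma,C,\kappa>0$ with $2C\kappa\ge 1$, and apply the controller $$u_i=-r_i(y,z)\nabla V(y)g_i(y),\qquad \dot z=\Gamma e^{-z}(V(y)-\varepsilon)^+,\quad z\in\mathbb R,$$ where $$r_i(y,z)=C(\kappa+e^z)s_i^2(y)(\nabla V(y)g_i(y))^2+(\kappa+e^z)s_i(y)+C^3(\kappa+e^z)^3P_i^2(y,z)(\nabla V(y)g_i(y))^2+C(\kappa+e^z)^2P_i(y,z),$$ $$P_i(y,z)=|\varphi_i(y)|^2+|A_i(y)|^2+(\kappa+e^z)^2\mu(y)+\delta_i^2(y).$$ For $s_1,s_2,s_4\ge 0$ and $s_3>0$ put $$\chi(s_1,s_2,s_3,s_4)=\frac{ms_1^2+m\sigma^2+m\bigl((s_2-\kappa-s_4)^+\bigr)^2+2C\kappa\Lambda+2ms_3\bigl((\tfrac1{s_3}-\kappa-s_4)^+\bigr)^2}{4C(\kappa+s_4)}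 .$$ Then there exist $\omega\in KL$, $\zeta\in K_\infty$ and a continuous function $R:\mathbb R^n\times\mathbb R\times\mathbb R_+^2\times(0,\infty)\to\mathbb R$ such that for every $(y_0,z_0)\in\mathbb R^n\times\mathbb R$ and all $d\in L^\infty(\mathbb R_+;\mathbb R^q)$, $\theta\in L^\infty(\mathbb R_+;\mathbb R^p)$, $b\in L^\infty(\mathbb R_+;(0,\infty)^m)$ with $\inf_{t\ge 0}b_i(t)>0$ for $i=1,\dots,m$, the closed-loop system with $(y(0),z(0))=(y_0,z_0)$ has a Carathéodory solution $(y,z)$ defined on $[0,\infty)$, every solution on an interval $[0,T)$ is a restriction of it, and, with $B:=\min_{i}\inf_{t\ge 0}b_i(t)$: (i) $\limsup_{t\to\infty}V(y(t))\le\varepsilon$; (ii) $V(y(t))\le\omega(V(y_0),t)+\zeta\bigl(\chi(\|d\|_\infty,\|\theta\|_\infty,B,e^{z_0})\bigr)$ for all $t\ge 0$; (iii) $z$ is nondecreasing, $\lim_{s\to\infty}z(s)$ exists and is finite, and for all $t\ge 0$ $$z_0\le z(t)\le\lim_{s\to\infty}z(s)\le R\bigl(y_0,z_0,\|d\|_\infty,\|\theta\|_\infty,B\bigr).$$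 Here $K_\infty$ is the class of continuous, strictly increasing, unbounded $a:\mathbb R_+\to\mathbb R_+$ with $a(0)=0$, and $KL$ is the class of continuous $\omega:\mathbb R_+\times\mathbb R_+\to\mathbb R_+$ such that, for each $t$, $\omega(\cdot,t)$ is continuous, strictly increasing and zero at $0$, and, for each $s$, $\omega(s,\cdot)$ is nonincreasing with limit $0$. -/

import Mathlib

open MeasureTheory Set Filter Topology
open scoped ContDiff

noncomputable section

namespace DADS

/-- `ℝⁿ` with the Euclidean norm. -/
abbrev Vec (n : ℕ) : Type := EuclideanSpace ℝ (Fin n)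

/-- Lebesgue measure on the half line `[0, ∞)`. -/
def halfLine : Measure ℝ := volume.restrict (Ici 0)

/-- Membership in `L^∞(ℝ₊; ℝᵏ)`; only the values at times `t ≥ 0` matter. -/
def EssBounded {k : ℕ} (w : ℝ → Vec k) : Prop := MemLp w ⊤ halfLine

/-- The essential supremum norm `‖w‖_∞` of an input on `[0, ∞)`. -/
def supNorm {k : ℕ} (w : ℝ → Vec k) : ℝ := (eLpNorm w ⊤ halfLine).toReal

/-- The smallest infimum `min_i inf_{t ≥ 0} b_i(t)` of the input coefficients. -/
def minInf {m : ℕ} (b : ℝ → Vec m) : ℝ := ⨅ i : Fin m, ⨅ t : Ici (0 : ℝ), b t i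

/-- Class `K`: continuous, (strictly) increasing functions `ℝ₊ → ℝ₊` vanishing at `0`. -/
def IsClassK (a : ℝ → ℝ) : Prop :=
  ContinuousOn a (Ici 0) ∧ StrictMonoOn a (Ici 0) ∧ a 0 = 0

/-- Class `K_∞`: unbounded class `K` functions. -/
def IsClassKInf (a : ℝ → ℝ) : Prop :=
  IsClassK a ∧ Tendsto a atTop atTop

/-- Class `KL`, for functions on `ℝ₊ × ℝ₊`. -/
def IsClassKL (β : ℝ → ℝ → ℝ) : Prop :=
  ContinuousOn (fun p : ℝ × ℝ => β p.1 p.2) (Ici 0 ×ˢ Ici 0) ∧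
  (∀ t, 0 ≤ t → IsClassK (fun s => β s t)) ∧
  (∀ s, 0 ≤ s → AntitoneOn (β s) (Ici 0) ∧ Tendsto (β s) atTop (𝓝 0))

/-- Positive definite function on `ℝⁿ`. -/
def PosDefFun {n : ℕ} (V : Vec n → ℝ) : Prop :=
  V 0 = 0 ∧ ∀ x, x ≠ 0 → 0 < V x

/-- Radially unbounded function on `ℝⁿ`: bounded sublevel sets are compact. -/
def RadiallyUnbounded {n : ℕ} (V : Vec n → ℝ) : Prop :=
  ∀ M : ℝ, 0 < M → IsCompact {x | V x ≤ M}

/-- The mappings of the plant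
`ẏ = f(y) + ∑ i, g_i(y) (b_i u_i + φ_i(y)ᵀ θ + A_i(y)ᵀ d)`. -/
structure Plant (n m p q : ℕ) where
  f : Vec n → Vec n
  g : Fin m → Vec n → Vec n
  φ : Fin m → Vec n → Vec p
  A : Fin m → Vec n → Vec q

/-- Standing assumptions on the plant: smooth mappings, `f(0) = 0`, `φ_i(0) = 0`. -/
structure Plant.Regular {n m p q : ℕ} (S : Plant n m p q) : Prop where
  smooth_f : ContDiff ℝ ∞ S.f
  smooth_g : ∀ i, ContDiff ℝ ∞ (S.g i)
  smooth_φ : ∀ i, ContDiff ℝ ∞ (S.φ i)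
  smooth_A : ∀ i, ContDiff ℝ ∞ (S.A i)
  f_zero : S.f 0 = 0
  φ_zero : ∀ i, S.φ i 0 = 0

/-- The functions and constants that appear in Assumptions (A) and (B). -/
structure LyapData (n m : ℕ) where
  V : Vec n → ℝ
  Q : Vec n → ℝ
  s : Fin m → Vec n → ℝ
  δ : Fin m → Vec n → ℝ
  σ : ℝ
  μ : Vec n → ℝ
  Λ : ℝ

/-- The Lie derivative `∇V(y) h(y)`. -/
def lieD {n : ℕ} (V : Vec n → ℝ) (h : Vec n → Vec n) (y : Vec n) : ℝ :=
  fderiv ℝ V y (h y)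

/-- Assumption (A). -/
structure AssumptionA {n m p q : ℕ} (S : Plant n m p q) (L : LyapData n m) : Prop where
  smooth_V : ContDiff ℝ ∞ L.V
  smooth_Q : ContDiff ℝ ∞ L.Q
  smooth_s : ∀ i, ContDiff ℝ ∞ (L.s i)
  smooth_δ : ∀ i, ContDiff ℝ ∞ (L.δ i)
  s_nonneg : ∀ i y, 0 ≤ L.s i y
  posDef_V : PosDefFun L.V
  posDef_Q : PosDefFun L.Q
  radial_V : RadiallyUnbounded L.V
  radial_Q : RadiallyUnbounded L.Q
  decrease : ∀ y, lieD L.V S.f y ≤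
    -L.Q y + L.σ * ∑ i, L.δ i y * lieD L.V (S.g i) y
      + ∑ i, L.s i y * (lieD L.V (S.g i) y) ^ 2

/-- Assumption (B). -/
structure AssumptionB {n m p q : ℕ} (S : Plant n m p q) (L : LyapData n m) : Prop where
  smooth_μ : ContDiff ℝ ∞ L.μ
  μ_pos : ∀ y, 0 < L.μ y
  Λ_nonneg : 0 ≤ L.Λ
  growth : ∀ y, ∑ i, ‖S.φ i y‖ ^ 2 ≤ L.μ y * (L.Q y + L.Λ)

/-- The constants of the controller. -/
structure Gains where
  ε : ℝ
  Γ : ℝ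
  C : ℝ
  κ : ℝ

/-- Admissible constants: all positive, with `2 C κ ≥ 1`. -/
def Gains.Admissible (K : Gains) : Prop :=
  0 < K.ε ∧ 0 < K.Γ ∧ 0 < K.C ∧ 0 < K.κ ∧ 1 ≤ 2 * K.C * K.κ

section ClosedLoop

variable {n m p q : ℕ} (S : Plant n m p q) (L : LyapData n m) (K : Gains)

/-- The functions `P_i(y, z)`. -/
def P (i : Fin m) (y : Vec n) (z : ℝ) : ℝ :=
  ‖S.φ i y‖ ^ 2 + ‖S.A i y‖ ^ 2 + (K.κ + Real.exp z) ^ 2 * L.μ y + (L.δ i y) ^ 2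

/-- The nonlinear damping gains `r_i(y, z)`. -/
def r (i : Fin m) (y : Vec n) (z : ℝ) : ℝ :=
  K.C * (K.κ + Real.exp z) * (L.s i y) ^ 2 * (lieD L.V (S.g i) y) ^ 2
    + (K.κ + Real.exp z) * L.s i y
    + K.C ^ 3 * (K.κ + Real.exp z) ^ 3 * (P S L K i y z) ^ 2 * (lieD L.V (S.g i) y) ^ 2
    + K.C * (K.κ + Real.exp z) ^ 2 * P S L K i y z

/-- The feedback `u_i = -r_i(y, z) ∇V(y) g_i(y)`. -/
def control (i : Fin m) (y : Vec n) (z : ℝ) : ℝ :=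
  -(r S L K i y z) * lieD L.V (S.g i) y

/-- Right-hand side of the plant under the feedback, for given values of `d`, `θ`, `b`. -/
def plantField (y : Vec n) (z : ℝ) (d : Vec q) (θ : Vec p) (b : Vec m) : Vec n :=
  S.f y + ∑ i, (b i * control S L K i y z + inner ℝ (S.φ i y) θ
    + inner ℝ (S.A i y) d) • S.g i y

/-- Right-hand side `Γ e^{-z} (V(y) - ε)⁺` of the adaptation law. -/
def adaptField (y : Vec n) (z : ℝ) : ℝ :=
  K.Γ * Real.exp (-z) * max (L.V y - K.ε) 0

/-- `(y, z)` is a (Carathéodory) solution, on the interval `I` of times starting at `0`, of the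
closed-loop initial-value problem. The differential equations with measurable inputs are written
in the usual integrated form, which says that `(y, z)` is locally absolutely continuous, satisfies
the differential equations almost everywhere, and starts at `(y₀, z₀)`. -/
structure IsSolutionOn (d : ℝ → Vec q) (θ : ℝ → Vec p) (b : ℝ → Vec m)
    (y₀ : Vec n) (z₀ : ℝ) (I : Set ℝ) (y : ℝ → Vec n) (z : ℝ → ℝ) : Prop where
  cont_y : ContinuousOn y I
  cont_z : ContinuousOn z I
  integrable_y : ∀ t ∈ I, IntervalIntegrable
    (fun τ => plantField S L K (y τ) (z τ) (d τ) (θ τ) (b τ)) volume 0 t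
  integrable_z : ∀ t ∈ I, IntervalIntegrable
    (fun τ => adaptField L K (y τ) (z τ)) volume 0 t
  eq_y : ∀ t ∈ I, y t = y₀ + ∫ τ in (0 : ℝ)..t,
    plantField S L K (y τ) (z τ) (d τ) (θ τ) (b τ)
  eq_z : ∀ t ∈ I, z t = z₀ + ∫ τ in (0 : ℝ)..t, adaptField L K (y τ) (z τ)

/-- The function `χ(s₁, s₂, s₃, s₄)`. -/
def χ (s₁ s₂ s₃ s₄ : ℝ) : ℝ :=
  ((m : ℝ) * s₁ ^ 2 + m * L.σ ^ 2 + m * (max (s₂ - K.κ - s₄) 0) ^ 2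
      + 2 * K.C * K.κ * L.Λ
      + 2 * m * s₃ * (max (1 / s₃ - K.κ - s₄) 0) ^ 2)
    / (4 * K.C * (K.κ + s₄))

end ClosedLoop

end DADS

end

/-! Put `c = κ + e^z`, `w_i = ∇V g_i` and `B = min_i inf b_i`. The number `c` serves as a common
guess for an upper bound of `|θ|` and of `1/B`. The gain is built so that `r_i w_i²` equals the sum
of `C c X² + c X` over `X = s_i w_i²` and `X = C c P_i w_i²`. The damping `b_i r_i w_i²` therefore
dominates both `X`, up to a residual that vanishes once `c ≥ 1/B` (`sub_damping_le`). The four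
summands of `P_i` absorb the cross terms by Young's inequality (`channel_le`). Of `θ`, only the
excess of `|θ|` over `c` costs a constant. The rest leaves `|φ_i|²/(4Ccμ)`, whose sum (B) bounds by
`(Q+Λ)/(4Cc)`, and `2Cκ ≥ 1` turns this into at most half of `Q` plus the `Λ`-term of `χ`. The
outcome is `V̇ ≤ -Q/2 + χ(…, e^z)` (`lieD_plantField_le`).

Three consequences follow. Choose `a ∈ K_∞` with `a ∘ V ≤ Q/2`. Since `z` is nondecreasing and `χ`
is nonincreasing in its last slot, comparison with `χ` frozen at `e^{z₀}` gives (ii).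

Since `(κ+s₄)χ` is nonincreasing, `χ ≤ a(ε)/2` as soon as `z` passes an explicit threshold. From
then on `((V-ε)⁺)²/2` decreases at rate at least `(a(ε)/2)(V-ε)⁺`, so `∫(V-ε)⁺` is bounded and `z`
can rise only by a bounded amount (`z_le`). All these bounds are independent of the length of the
interval of existence, so solutions are global.

Finally `z` converges while `V` rises at bounded speed. A value of `V` above `ε + η` at a late time
would force a definite increase of `z` on a preceding window of fixed length, which is impossible;
this is (i). -/

noncomputable section

namespace DADS

/-! ### Existence and uniqueness for Carathéodory equations -/

section Caratheodory

variable {E W : Type*} [NormedAddCommGroup E] [NormedSpace ℝ E]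
  [NormedAddCommGroup W]

/-- Solutions on `I`, in integrated form, of `ẋ = G(t, x)`, `x(0) = x₀`. -/
structure IsIntegralSol (G : ℝ → E → E) (x₀ : E) (I : Set ℝ) (x : ℝ → E) : Prop where
  cont : ContinuousOn x I
  integrable : ∀ t ∈ I, IntervalIntegrable (fun τ => G τ (x τ)) volume 0 t
  eq : ∀ t ∈ I, x t = x₀ + ∫ τ in (0 : ℝ)..t, G τ (x τ)

lemma IsIntegralSol.mono {G : ℝ → E → E} {x₀ : E} {I J : Set ℝ} {x : ℝ → E}
    (h : IsIntegralSol G x₀ I x) (hJ : J ⊆ I) : IsIntegralSol G x₀ J x :=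
  ⟨h.cont.mono hJ, fun t ht => h.integrable t (hJ ht), fun t ht => h.eq t (hJ ht)⟩

/-- Changing the right-hand side along the trajectory on a null set of times. -/
lemma IsIntegralSol.congr {G G' : ℝ → E → E} {x₀ : E} {T : ℝ} {x : ℝ → E}
    (h : IsIntegralSol G x₀ (Icc 0 T) x)
    (hG : ∀ᵐ τ, τ ∈ Icc 0 T → G τ (x τ) = G' τ (x τ)) :
    IsIntegralSol G' x₀ (Icc 0 T) x := by
  have key : ∀ t ∈ Icc 0 T, ∀ᵐ τ, τ ∈ uIoc 0 t → G τ (x τ) = G' τ (x τ) := by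
    intro t ht
    filter_upwards [hG] with τ hτ hmem
    rw [uIoc_of_le ht.1] at hmem
    exact hτ ⟨hmem.1.le, hmem.2.trans ht.2⟩
  refine ⟨h.cont, fun t ht => ?_, fun t ht => ?_⟩
  · exact (h.integrable t ht).congr_ae ((ae_restrict_iff' measurableSet_uIoc).2 (key t ht))
  · rw [h.eq t ht, intervalIntegral.integral_congr_ae (key t ht)]

/-- The radial retraction onto the closed ball of radius `r`. -/
def radialProj (r : ℝ) (x : E) : E := (r / max r ‖x‖) • x

lemma radialProj_of_norm_le {r : ℝ} (hr : 0 < r) {x : E} (hx : ‖x‖ ≤ r) :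
    radialProj r x = x := by
  rw [radialProj, max_eq_left hx, div_self hr.ne', one_smul]

lemma norm_radialProj_le {r : ℝ} (hr : 0 < r) (x : E) : ‖radialProj r x‖ ≤ r := by
  have hm : 0 < max r ‖x‖ := lt_max_of_lt_left hr
  rw [radialProj, norm_smul, Real.norm_of_nonneg (by positivity), div_mul_eq_mul_div,
    div_le_iff₀ hm]
  gcongr
  exact le_max_right _ _

/-- Moving the point and changing the scaling factor each cost at most `‖x - y‖`. The constant 2
works in any normed space; the state space `Vec n × ℝ` carries a maximum norm, so nonexpansiveness
of projections in Hilbert spaces is not available. -/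
lemma norm_radialProj_sub_le {r : ℝ} (hr : 0 < r) (x y : E) :
    ‖radialProj r x - radialProj r y‖ ≤ 2 * ‖x - y‖ := by
  have hx : 0 < max r ‖x‖ := lt_max_of_lt_left hr
  have hy : 0 < max r ‖y‖ := lt_max_of_lt_left hr
  have hsplit : radialProj r x - radialProj r y
      = (r / max r ‖x‖) • (x - y) + (r / max r ‖x‖ - r / max r ‖y‖) • y := by
    simp only [radialProj]; module
  have h1 : ‖(r / max r ‖x‖) • (x - y)‖ ≤ ‖x - y‖ := by
    rw [norm_smul, Real.norm_of_nonneg (by positivity)]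
    refine mul_le_of_le_one_left (norm_nonneg _) ?_
    rw [div_le_one hx]; exact le_max_left _ _
  have h2 : ‖(r / max r ‖x‖ - r / max r ‖y‖) • y‖ ≤ ‖x - y‖ := by
    have e : r / max r ‖x‖ - r / max r ‖y‖
        = (r / max r ‖x‖) * (max r ‖y‖ - max r ‖x‖) / max r ‖y‖ := by
      field_simp
    have hd : |max r ‖y‖ - max r ‖x‖| ≤ ‖x - y‖ := by
      have := abs_max_sub_max_le_max r ‖y‖ r ‖x‖
      rw [sub_self, abs_zero, max_eq_right (a := (0 : ℝ)) (abs_nonneg _)] at this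
      exact this.trans (by rw [norm_sub_rev]; exact abs_norm_sub_norm_le _ _)
    rw [norm_smul, e, Real.norm_eq_abs, abs_div, abs_mul, abs_of_pos hy,
      abs_of_nonneg (show 0 ≤ r / max r ‖x‖ by positivity)]
    have h3 : r / max r ‖x‖ ≤ 1 := by rw [div_le_one hx]; exact le_max_left _ _
    have h4 : ‖y‖ / max r ‖y‖ ≤ 1 := by rw [div_le_one hy]; exact le_max_right _ _
    calc r / max r ‖x‖ * |max r ‖y‖ - max r ‖x‖| / max r ‖y‖ * ‖y‖
        = (r / max r ‖x‖) * (‖y‖ / max r ‖y‖) * |max r ‖y‖ - max r ‖x‖| := by ring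
      _ ≤ 1 * 1 * ‖x - y‖ := by gcongr
      _ = ‖x - y‖ := by ring
  rw [hsplit]
  linarith [norm_add_le ((r / max r ‖x‖) • (x - y)) ((r / max r ‖x‖ - r / max r ‖y‖) • y)]

lemma continuous_radialProj {r : ℝ} (hr : 0 < r) : Continuous (radialProj (E := E) r) :=
  (LipschitzWith.of_dist_le_mul (K := 2) fun x y => by
    simpa [dist_eq_norm] using norm_radialProj_sub_le hr x y).continuous

lemma integral_exp_mul {lam : ℝ} (hlam : lam ≠ 0) (s : ℝ) :
    ∫ τ in (0 : ℝ)..s, Real.exp (lam * τ) = (Real.exp (lam * s) - 1) / lam := by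
  have h : ∀ τ ∈ uIcc 0 s,
      HasDerivAt (fun τ => Real.exp (lam * τ) / lam) (Real.exp (lam * τ)) τ := by
    intro τ _
    have h1 : HasDerivAt (fun τ => lam * τ) lam τ := by
      simpa using (hasDerivAt_id τ).const_mul lam
    simpa [hlam] using h1.exp.div_const lam
  rw [intervalIntegral.integral_eq_sub_of_hasDerivAt h
    ((by fun_prop : Continuous fun τ : ℝ => Real.exp (lam * τ)).intervalIntegrable _ _)]
  simp [sub_div]

/-- Global existence for a bounded right-hand side that is Lipschitz in the state. -/
theorem exists_isIntegralSol_of_lipschitz [CompleteSpace E] {G : ℝ → E → E} {K M : ℝ}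
    (hK : 0 ≤ K) (hM : 0 ≤ M)
    (hmeas : ∀ x : ℝ → E, Continuous x → AEStronglyMeasurable (fun τ => G τ (x τ)) volume)
    (hlip : ∀ τ x y, ‖G τ x - G τ y‖ ≤ K * ‖x - y‖)
    (hbd : ∀ τ x, ‖G τ x‖ ≤ M) (x₀ : E) :
    ∃ x : ℝ → E, Continuous x ∧ (∀ t, t ≤ 0 → x t = x₀) ∧ IsIntegralSol G x₀ (Ici 0) x := by
  have hint : ∀ x : ℝ → E, Continuous x → ∀ a b,
      IntervalIntegrable (fun τ => G τ (x τ)) volume a b := fun x hx a b =>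
    (intervalIntegrable_const (c := M)).mono_fun (hmeas x hx).restrict
      (ae_of_all _ fun τ => by simpa [abs_of_nonneg hM] using hbd τ (x τ))
  -- Picard iteration in a weighted norm: the unknown is `u(t) = e^{-lam t} x(t)`, for which the
  -- integral operator contracts by `K / lam < 1` on the whole half line at once.
  set lam : ℝ := K + 1 with hlamdef
  have hlam : 0 < lam := by positivity
  let X : (BoundedContinuousFunction ℝ E) → ℝ → E := fun u τ => Real.exp (lam * τ) • u τ
  have hX : ∀ u, Continuous (X u) := fun u => by
    have := u.continuous
    fun_prop
  let I : (BoundedContinuousFunction ℝ E) → ℝ → E := fun u t =>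
    Real.exp (-(lam * max t 0)) • (x₀ + ∫ τ in (0 : ℝ)..(max t 0), G τ (X u τ))
  have hIc : ∀ u, Continuous (I u) := fun u => by
    have h1 : Continuous fun s => ∫ τ in (0 : ℝ)..s, G τ (X u τ) :=
      intervalIntegral.continuous_primitive (fun a b => hint _ (hX u) a b) 0
    have h2 : Continuous fun t : ℝ => max t 0 := by fun_prop
    have h3 := h1.comp h2
    simp only [Function.comp_def] at h3
    fun_prop
  have hIb : ∀ u t, ‖I u t‖ ≤ ‖x₀‖ + M / lam := fun u t => by
    have hs : 0 ≤ max t 0 := le_max_right _ _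
    generalize hsd : max t 0 = s at hs
    have h1 : ‖∫ τ in (0 : ℝ)..s, G τ (X u τ)‖ ≤ M * |s - 0| :=
      intervalIntegral.norm_integral_le_of_norm_le_const fun τ _ => hbd τ _
    rw [sub_zero, abs_of_nonneg hs] at h1
    have h2 : Real.exp (-(lam * s)) * s ≤ 1 / lam := by
      rw [Real.exp_neg, inv_mul_eq_div, div_le_div_iff₀ (Real.exp_pos _) hlam]
      linarith [Real.add_one_le_exp (lam * s)]
    have h3 : Real.exp (-(lam * s)) ≤ 1 := Real.exp_le_one_iff.2 (by nlinarith)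
    simp only [I, hsd]
    rw [norm_smul, Real.norm_of_nonneg (Real.exp_pos _).le]
    calc Real.exp (-(lam * s)) * ‖x₀ + ∫ τ in (0 : ℝ)..s, G τ (X u τ)‖
        ≤ Real.exp (-(lam * s)) * (‖x₀‖ + M * s) := by
          gcongr; exact (norm_add_le _ _).trans (by gcongr)
      _ = Real.exp (-(lam * s)) * ‖x₀‖ + M * (Real.exp (-(lam * s)) * s) := by ring
      _ ≤ 1 * ‖x₀‖ + M * (1 / lam) := by gcongr
      _ = ‖x₀‖ + M / lam := by ring
  let Φ : (BoundedContinuousFunction ℝ E) → (BoundedContinuousFunction ℝ E) := fun u =>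
    BoundedContinuousFunction.ofNormedAddCommGroup (I u) (hIc u) _ (hIb u)
  have hk : (K / lam) < 1 := by rw [div_lt_one hlam]; linarith
  have hΦ : ContractingWith (Real.toNNReal (K / lam)) Φ := by
    refine ⟨by rw [← NNReal.coe_lt_coe, Real.coe_toNNReal _ (by positivity)]; simpa using hk,
      LipschitzWith.of_dist_le_mul fun u v => ?_⟩
    rw [Real.coe_toNNReal _ (by positivity), BoundedContinuousFunction.dist_le (by positivity)]
    intro t
    change dist (I u t) (I v t) ≤ _
    have hs : 0 ≤ max t 0 := le_max_right _ _
    simp only [I]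
    generalize max t 0 = s at hs
    rw [dist_eq_norm, ← smul_sub, add_sub_add_left_eq_sub,
      ← intervalIntegral.integral_sub (hint _ (hX u) _ _) (hint _ (hX v) _ _), norm_smul,
      Real.norm_of_nonneg (Real.exp_pos _).le]
    have h1 : ‖∫ τ in (0 : ℝ)..s, (G τ (X u τ) - G τ (X v τ))‖
        ≤ ∫ τ in (0 : ℝ)..s, (K * dist u v) * Real.exp (lam * τ) := by
      refine intervalIntegral.norm_integral_le_of_norm_le hs (ae_of_all _ fun τ _ => ?_)
        ((by fun_prop : Continuous fun τ : ℝ =>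
          (K * dist u v) * Real.exp (lam * τ)).intervalIntegrable _ _)
      refine (hlip τ _ _).trans ?_
      simp only [X]
      rw [← smul_sub, norm_smul, Real.norm_of_nonneg (Real.exp_pos _).le, ← dist_eq_norm]
      have := BoundedContinuousFunction.dist_coe_le_dist (f := u) (g := v) τ
      calc K * (Real.exp (lam * τ) * dist (u τ) (v τ))
          ≤ K * (Real.exp (lam * τ) * dist u v) := by gcongr
        _ = _ := by ring
    rw [intervalIntegral.integral_const_mul, integral_exp_mul hlam.ne'] at h1
    have h2 : Real.exp (-(lam * s)) * (Real.exp (lam * s) - 1) ≤ 1 := by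
      rw [mul_sub, ← Real.exp_add]
      simp [(Real.exp_pos _).le]
    calc Real.exp (-(lam * s)) * ‖∫ τ in (0 : ℝ)..s, (G τ (X u τ) - G τ (X v τ))‖
        ≤ Real.exp (-(lam * s)) * (K * dist u v * ((Real.exp (lam * s) - 1) / lam)) := by gcongr
      _ = (K / lam * dist u v) * (Real.exp (-(lam * s)) * (Real.exp (lam * s) - 1)) := by ring
      _ ≤ (K / lam * dist u v) * 1 := by gcongr
      _ = _ := mul_one _
  obtain ⟨u, hu, -⟩ := hΦ.exists_fixedPoint 0 (edist_ne_top _ _)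
  have hut : ∀ t, I u t = u t := fun t => congrArg (fun f => f t) hu
  refine ⟨fun t => X u (max t 0), (hX u).comp (by fun_prop), fun t ht => ?_, ?_⟩
  · simp only [max_eq_right ht, X]
    rw [← hut 0]; simp [I]
  · have heqI : ∀ t, 0 ≤ t → ∀ τ ∈ uIcc 0 t, G τ (X u (max τ 0)) = G τ (X u τ) := by
      intro t ht τ hτ
      rw [uIcc_of_le ht] at hτ
      rw [max_eq_left hτ.1]
    refine ⟨((hX u).comp (by fun_prop : Continuous fun t : ℝ => max t 0)).continuousOn,
      fun t ht => hint _ ((hX u).comp (by fun_prop : Continuous fun t : ℝ => max t 0)) _ _,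
      fun t ht => ?_⟩
    have ht' : (0 : ℝ) ≤ t := ht
    rw [intervalIntegral.integral_congr (heqI t ht'), max_eq_left ht']
    simp only [X]
    rw [← hut t]
    simp only [I, max_eq_left ht', smul_smul, ← Real.exp_add, add_neg_cancel, Real.exp_zero,
      one_smul]
    rfl

/-- Uniqueness, by Gronwall's inequality. -/
theorem IsIntegralSol.eqOn {G : ℝ → E → E} {x₀ : E} {T K : ℝ} {x y : ℝ → E}
    (hx : IsIntegralSol G x₀ (Icc 0 T) x) (hy : IsIntegralSol G x₀ (Icc 0 T) y)
    (hlip : ∀ᵐ τ, τ ∈ Icc 0 T → ‖G τ (x τ) - G τ (y τ)‖ ≤ K * ‖x τ - y τ‖) :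
    EqOn x y (Icc 0 T) := by
  intro s hs
  have hT : 0 ≤ T := hs.1.trans hs.2
  let u : ℝ → ℝ := fun t => ‖x (projIcc 0 T hT t) - y (projIcc 0 T hT t)‖
  have hu : Continuous u := by
    have h1 := hx.cont.domRestrict.comp (continuous_projIcc (h := hT))
    have h2 := hy.cont.domRestrict.comp (continuous_projIcc (h := hT))
    exact (h1.sub h2).norm
  have hu' : ∀ t ∈ Icc 0 T, u t = ‖x t - y t‖ := fun t ht => by
    simp only [u, projIcc_of_mem hT ht]
  have hle : ∀ t ∈ Icc 0 T, u t ≤ K * ∫ τ in (0 : ℝ)..t, u τ := by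
    intro t ht
    rw [hu' t ht, hx.eq t ht, hy.eq t ht, add_sub_add_left_eq_sub,
      ← intervalIntegral.integral_sub (hx.integrable t ht) (hy.integrable t ht),
      ← intervalIntegral.integral_const_mul]
    refine intervalIntegral.norm_integral_le_of_norm_le ht.1 ?_
      ((hu.const_mul K).intervalIntegrable _ _)
    filter_upwards [hlip] with τ hτ hmem
    have hm : τ ∈ Icc 0 T := ⟨hmem.1.le, hmem.2.trans ht.2⟩
    rw [hu' τ hm]
    exact hτ hm
  have hder : ∀ t, HasDerivAt (fun t => ∫ τ in (0 : ℝ)..t, u τ) (u t) t := fun t =>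
    intervalIntegral.integral_hasDerivAt_right (hu.intervalIntegrable _ _)
      (hu.stronglyMeasurableAtFilter _ _) hu.continuousAt
  have hnn : ∀ t ∈ Icc 0 T, 0 ≤ ∫ τ in (0 : ℝ)..t, u τ := fun t ht =>
    intervalIntegral.integral_nonneg ht.1 fun τ _ => norm_nonneg _
  -- Gronwall is applied to the primitive of `u`, which is differentiable, whereas `u` is only
  -- continuous.
  have hg := norm_le_gronwallBound_of_norm_deriv_right_le
    (f := fun t => ∫ τ in (0 : ℝ)..t, u τ) (f' := u) (δ := 0) (K := K) (ε := 0) (a := 0) (b := T)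
    (fun t _ => (hder t).continuousAt.continuousWithinAt)
    (fun t _ => (hder t).hasDerivWithinAt) (by simp) (by
      intro t ht
      have ht' : t ∈ Icc 0 T := ⟨ht.1, ht.2.le⟩
      rw [Real.norm_of_nonneg (norm_nonneg _), Real.norm_of_nonneg (hnn t ht'), add_zero]
      exact hle t ht') s hs
  rw [gronwallBound_ε0_δ0] at hg
  have h0 : ∫ τ in (0 : ℝ)..s, u τ = 0 := norm_le_zero_iff.1 hg
  have := hle s hs
  rw [h0, mul_zero, hu' s hs] at this
  exact sub_eq_zero.1 (norm_le_zero_iff.1 this)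

/-- A locally Lipschitz system driven by an essentially bounded input whose solutions obey an
a priori bound has a unique global solution. -/
theorem exists_global_isIntegralSol [ProperSpace E] [ProperSpace W] {F : E × W → E}
    (hF : LocallyLipschitz F) {w : ℝ → W} {M ρ : ℝ} (hM : 0 ≤ M) (hρ : 0 < ρ)
    (hwm : AEStronglyMeasurable w (volume.restrict (Ici 0)))
    (hwb : ∀ᵐ t ∂(volume.restrict (Ici (0 : ℝ))), ‖w t‖ ≤ M) (x₀ : E)
    (hap : ∀ (T : ℝ) (x : ℝ → E), IsIntegralSol (fun t x => F (x, w t)) x₀ (Icc 0 T) x →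
      ∀ t ∈ Icc 0 T, ‖x t‖ < ρ) :
    ∃ x : ℝ → E, Continuous x ∧ (∀ t, t ≤ 0 → x t = x₀) ∧
      IsIntegralSol (fun t x => F (x, w t)) x₀ (Ici 0) x ∧
      ∀ (T : ℝ) (y : ℝ → E), IsIntegralSol (fun t x => F (x, w t)) x₀ (Ico 0 T) y →
        EqOn y x (Ico 0 T) := by
  classical
  have hFc : Continuous F := hF.continuous
  set C : Set (E × W) := Metric.closedBall 0 ρ ×ˢ Metric.closedBall 0 M with hCdef
  have hC : IsCompact C := (isCompact_closedBall _ _).prod (isCompact_closedBall _ _)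
  obtain ⟨K, hK⟩ := LocallyLipschitzOn.exists_lipschitzOnWith_of_compact hC
    (hF.locallyLipschitzOn (s := C))
  obtain ⟨B, hB⟩ := hC.exists_bound_of_continuousOn hFc.continuousOn
  -- Altering the input on a null set, and at negative times, makes its bound hold everywhere. With
  -- the state retracted to a ball, the field is then globally bounded and Lipschitz.
  let w' : ℝ → W := fun t => if 0 ≤ t ∧ ‖w t‖ ≤ M then w t else 0
  have hw'b : ∀ t, ‖w' t‖ ≤ M := fun t => by
    simp only [w']; split_ifs with h
    · exact h.2
    · simpa using hM
  have hww' : ∀ᵐ t, 0 ≤ t → w t = w' t := by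
    rw [ae_restrict_iff' measurableSet_Ici] at hwb
    filter_upwards [hwb] with t ht h0
    simp [w', h0, ht h0]
  have hw'm : AEStronglyMeasurable w' volume := by
    have h1 : AEStronglyMeasurable ((Ici (0 : ℝ)).indicator w) volume :=
      (aestronglyMeasurable_indicator_iff measurableSet_Ici).2 hwm
    refine h1.congr ?_
    filter_upwards [hww'] with t ht
    by_cases h0 : 0 ≤ t
    · rw [indicator_of_mem (mem_Ici.2 h0), ht h0]
    · rw [indicator_of_notMem (by simpa using h0)]
      simp [w', h0]
  have hmem : ∀ x t, (radialProj ρ x, w' t) ∈ C := fun x t =>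
    ⟨by simpa using norm_radialProj_le hρ x, by simpa using hw'b t⟩
  let G : ℝ → E → E := fun t x => F (radialProj ρ x, w' t)
  have hlip : ∀ t x y, ‖G t x - G t y‖ ≤ (2 * K) * ‖x - y‖ := fun t x y => by
    have h1 := hK.dist_le_mul _ (hmem x t) _ (hmem y t)
    rw [Prod.dist_eq, dist_self, max_eq_left dist_nonneg, dist_eq_norm, dist_eq_norm] at h1
    calc _ ≤ K * ‖radialProj ρ x - radialProj ρ y‖ := h1
      _ ≤ K * (2 * ‖x - y‖) := by gcongr; exact norm_radialProj_sub_le hρ x y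
      _ = _ := by ring
  obtain ⟨x, hxc, hx0, hx⟩ := exists_isIntegralSol_of_lipschitz (G := G)
    (K := 2 * K) (M := max B 0) (by positivity) (le_max_right _ _)
    (fun x hx => hFc.comp_aestronglyMeasurable
      (((continuous_radialProj hρ).comp hx).aestronglyMeasurable.prodMk hw'm))
    hlip (fun t x => (hB _ (hmem x t)).trans (le_max_left _ _)) x₀
  have hGF : ∀ (T : ℝ) (y : ℝ → E), (∀ t ∈ Icc 0 T, ‖y t‖ ≤ ρ) →
      ∀ᵐ τ, τ ∈ Icc 0 T → G τ (y τ) = F (y τ, w τ) := by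
    intro T y hy
    filter_upwards [hww'] with τ hτ hm
    simp only [G]
    rw [radialProj_of_norm_le hρ (hy τ hm), hτ hm.1]
  -- At a first time `T` with `‖x T‖ ≥ ρ` the truncation is still inactive on `[0, T]`. So `x`
  -- solves the original equation there, and the strict a priori bound is contradicted.
  have hin : ∀ t, 0 ≤ t → ‖x t‖ < ρ := by
    by_contra! hcon
    obtain ⟨t₁, ht₁, ht₁'⟩ := hcon
    have hne : (Icc 0 t₁ ∩ {t | ρ ≤ ‖x t‖}).Nonempty := ⟨t₁, ⟨ht₁, le_rfl⟩, ht₁'⟩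
    have hcp : IsCompact (Icc 0 t₁ ∩ {t | ρ ≤ ‖x t‖}) :=
      isCompact_Icc.inter_right (isClosed_le continuous_const hxc.norm)
    obtain ⟨T, ⟨hT, hTρ⟩, hmin⟩ := hcp.exists_isLeast hne
    have hlt : ∀ t ∈ Ico 0 T, ‖x t‖ < ρ := fun t ht => by
      by_contra! h
      exact absurd (hmin ⟨⟨ht.1, ht.2.le.trans hT.2⟩, h⟩) (not_le.2 ht.2)
    have h0 : ‖x 0‖ < ρ := by
      have := hap 0 (fun _ => x₀) ⟨continuousOn_const, fun t ht => by
        obtain rfl : t = 0 := le_antisymm ht.2 ht.1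
        simp, fun t ht => by
        obtain rfl : t = 0 := le_antisymm ht.2 ht.1
        simp⟩ 0 (by simp)
      rwa [hx0 0 le_rfl]
    have hTpos : 0 < T := by
      rcases hT.1.eq_or_lt with h | h
      · rw [← h] at hTρ; exact absurd hTρ (not_le.2 h0)
      · exact h
    have hle : ∀ t ∈ Icc 0 T, ‖x t‖ ≤ ρ := by
      have hcl : closure (Ico 0 T) = Icc 0 T := closure_Ico hTpos.ne
      intro t ht
      rw [← hcl] at ht
      exact closure_minimal (fun t ht => (hlt t ht).le)
        (isClosed_le hxc.norm continuous_const) ht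
    have := hap T x ((hx.mono Icc_subset_Ici_self).congr (hGF T x hle)) T ⟨hT.1, le_rfl⟩
    exact absurd hTρ (not_le.2 this)
  have hsol : ∀ T, IsIntegralSol (fun t x => F (x, w t)) x₀ (Icc 0 T) x := fun T =>
    (hx.mono Icc_subset_Ici_self).congr (hGF T x fun t ht => (hin t ht.1).le)
  refine ⟨x, hxc, hx0, ⟨hxc.continuousOn, fun t ht => (hsol t).integrable t ⟨ht, le_rfl⟩,
    fun t ht => (hsol t).eq t ⟨ht, le_rfl⟩⟩, fun T y hy t ht => ?_⟩
  have hy' := hy.mono (J := Icc 0 t) fun s hs => ⟨hs.1, hs.2.trans_lt ht.2⟩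
  have hyG : IsIntegralSol G x₀ (Icc 0 t) y := hy'.congr (by
    filter_upwards [hGF t y fun s hs => (hap t y hy' s hs).le] with τ h1 h2
    exact (h1 h2).symm)
  exact hyG.eqOn (K := 2 * K) (hx.mono Icc_subset_Ici_self)
    (ae_of_all _ fun τ _ => hlip τ _ _) ⟨ht.1, le_rfl⟩

end Caratheodory

/-! ### Comparison functions -/

section ComparisonFunctions

lemma IsClassK.nonneg {a : ℝ → ℝ} (ha : IsClassK a) {x : ℝ} (hx : 0 ≤ x) : 0 ≤ a x := by
  have := ha.2.1.monotoneOn (self_mem_Ici (a := (0 : ℝ))) hx hx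
  rwa [ha.2.2] at this

lemma IsClassK.pos {a : ℝ → ℝ} (ha : IsClassK a) {x : ℝ} (hx : 0 < x) : 0 < a x := by
  have := ha.2.1 (self_mem_Ici (a := (0 : ℝ))) hx.le hx
  rwa [ha.2.2] at this

lemma IsClassKInf.exists_eq {a : ℝ → ℝ} (ha : IsClassKInf a) {y : ℝ} (hy : 0 ≤ y) :
    ∃ x, 0 ≤ x ∧ a x = y := by
  obtain ⟨T, hT⟩ := (ha.2.eventually_ge_atTop y).exists_forall_of_atTop
  have h1 := hT (max T 0) (le_max_left _ _)
  obtain ⟨x, hx, hxy⟩ := intermediate_value_Icc (le_max_right T 0)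
    (ha.1.1.mono Icc_subset_Ici_self) ⟨by rwa [ha.1.2.2], h1⟩
  exact ⟨x, hx.1, hxy⟩

/-- A right inverse on `[0, ∞)` of a class `K_∞` function is of class `K_∞`. -/
lemma IsClassKInf.inverse {a b : ℝ → ℝ} (ha : IsClassKInf a)
    (hb : ∀ y, 0 ≤ y → 0 ≤ b y ∧ a (b y) = y) : IsClassKInf b := by
  have hmono : StrictMonoOn b (Ici 0) := by
    intro x hx y hy hxy
    by_contra! h
    have := ha.1.2.1.monotoneOn (hb y hy).1 (hb x hx).1 h
    rw [(hb x hx).2, (hb y hy).2] at this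
    exact absurd hxy (not_lt.2 this)
  have hba : ∀ x, 0 ≤ x → b (a x) = x := fun x hx =>
    ha.1.2.1.injOn (hb _ (ha.1.nonneg hx)).1 hx (hb _ (ha.1.nonneg hx)).2
  have hb0 : b 0 = 0 := by simpa [ha.1.2.2] using hba 0 le_rfl
  refine ⟨⟨?_, hmono, hb0⟩, ?_⟩
  · let B : Ici (0 : ℝ) → Ici (0 : ℝ) := fun y => ⟨b y, (hb y y.2).1⟩
    have hB : Continuous B := by
      apply Monotone.continuous_of_surjective
      · intro x y hxy; exact hmono.monotoneOn x.2 y.2 hxy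
      · intro x; exact ⟨⟨a x, ha.1.nonneg x.2⟩, Subtype.ext (hba x x.2)⟩
    rw [continuousOn_iff_continuous_domRestrict]
    exact continuous_subtype_val.comp hB
  · refine tendsto_atTop.2 fun c => ?_
    filter_upwards [eventually_ge_atTop (a (max c 0))] with y hy
    have h0 : 0 ≤ a (max c 0) := ha.1.nonneg (le_max_right _ _)
    have := hmono.monotoneOn h0 (h0.trans hy) hy
    rw [hba _ (le_max_right _ _)] at this
    exact (le_max_left _ _).trans this

/-- This is the map inverted to define `β(·, t)`; the identity summand supplies unboundedness even
when `a` is bounded. -/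
lemma IsClassK.isClassKInf_id_add_mul {a : ℝ → ℝ} (ha : IsClassK a) {t : ℝ} (ht : 0 ≤ t) :
    IsClassKInf (fun x => x + t * a x) := by
  refine ⟨⟨continuousOn_id.add (ha.1.const_mul t), ?_, by simp [ha.2.2]⟩, ?_⟩
  · intro x hx y hy hxy
    have := mul_le_mul_of_nonneg_left (ha.2.1.monotoneOn hx hy hxy.le) ht
    change x + t * a x < y + t * a y
    linarith
  · refine tendsto_atTop_mono' _ ?_ tendsto_id
    filter_upwards [eventually_ge_atTop 0] with x hx
    have := mul_nonneg ht (ha.nonneg hx)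
    simp only [id]; linarith

/-- The solution `r = β(s, t)` of `r + t a(r) = s` is a class `KL` function. -/
lemma IsClassK.isClassKL_of_add_mul_eq {a : ℝ → ℝ} (ha : IsClassK a) {β : ℝ → ℝ → ℝ}
    (hβ : ∀ s t, 0 ≤ s → 0 ≤ t → 0 ≤ β s t ∧ β s t + t * a (β s t) = s) : IsClassKL β := by
  have hle : ∀ s t, 0 ≤ s → 0 ≤ t → β s t ≤ s := fun s t hs ht => by
    have h := hβ s t hs ht
    nlinarith [mul_nonneg ht (ha.nonneg h.1)]
  -- Subtract the two defining equations and use the monotonicity of `a`. This one-sided estimate,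
  -- used in both directions, gives joint continuity.
  have hdiff : ∀ s t s' t', 0 ≤ s → 0 ≤ t → 0 ≤ s' → 0 ≤ t' →
      β s t - β s' t' ≤ |s - s'| + |t - t'| * a (β s' t') := by
    intro s t s' t' hs ht hs' ht'
    have h := hβ s t hs ht
    have h' := hβ s' t' hs' ht'
    have ha' := ha.nonneg h'.1
    rcases le_total (β s t) (β s' t') with hc | hc
    · have := abs_nonneg (s - s')
      have := mul_nonneg (abs_nonneg (t - t')) ha'
      linarith
    · have h1 := mul_le_mul_of_nonneg_left (ha.2.1.monotoneOn h'.1 h.1 hc) ht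
      have h2 : (t' - t) * a (β s' t') ≤ |t - t'| * a (β s' t') := by
        gcongr; rw [abs_sub_comm]; exact le_abs_self _
      have h3 := le_abs_self (s - s')
      nlinarith
  refine ⟨?_, fun t ht => ?_, fun s hs => ⟨?_, ?_⟩⟩
  · rintro ⟨s', t'⟩ ⟨hs', ht'⟩
    have hs' : 0 ≤ s' := hs'
    have ht' : 0 ≤ t' := ht'
    rw [ContinuousWithinAt, tendsto_iff_dist_tendsto_zero]
    have hlim : Tendsto (fun p : ℝ × ℝ => |p.1 - s'| + |p.2 - t'| * (a s' + a (|p.1|)))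
        (𝓝[Ici 0 ×ˢ Ici 0] (s', t')) (𝓝 (|s' - s'| + |t' - t'| * (a s' + a |s'|))) := by
      have hac : ContinuousAt (fun p : ℝ × ℝ => a (|p.1|)) (s', t') := by
        have h1 : Continuous (fun x : ℝ => a |x|) :=
          ha.1.comp_continuous continuous_abs fun x => abs_nonneg x
        exact (h1.comp continuous_fst).continuousAt
      have h2 : ContinuousAt (fun p : ℝ × ℝ => |p.1 - s'| + |p.2 - t'| * (a s' + a (|p.1|)))
          (s', t') :=
        (by fun_prop : ContinuousAt (fun p : ℝ × ℝ => |p.1 - s'|) (s', t')).add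
          ((by fun_prop : ContinuousAt (fun p : ℝ × ℝ => |p.2 - t'|) (s', t')).mul
            (continuousAt_const.add hac))
      exact h2.tendsto.mono_left nhdsWithin_le_nhds
    simp only [sub_self, abs_zero, zero_mul, add_zero] at hlim
    refine squeeze_zero' (Eventually.of_forall fun _ => dist_nonneg) ?_ hlim
    filter_upwards [self_mem_nhdsWithin] with p hp
    have hp1 : 0 ≤ p.1 := hp.1
    have hp2 : 0 ≤ p.2 := hp.2
    have e1 := hdiff p.1 p.2 s' t' hp1 hp2 hs' ht'
    have e2 := hdiff s' t' p.1 p.2 hs' ht' hp1 hp2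
    rw [abs_sub_comm s', abs_sub_comm t'] at e2
    have m1 := ha.2.1.monotoneOn (hβ s' t' hs' ht').1 hs' (hle s' t' hs' ht')
    have m2 := ha.2.1.monotoneOn (hβ _ _ hp1 hp2).1 hp1 (hle _ _ hp1 hp2)
    have n1 := ha.nonneg hs'
    have n2 := ha.nonneg hp1
    rw [Real.dist_eq, abs_le, abs_of_nonneg hp1]
    have k1 : |p.2 - t'| * a (β s' t') ≤ |p.2 - t'| * (a s' + a p.1) := by gcongr; linarith
    have k2 : |p.2 - t'| * a (β p.1 p.2) ≤ |p.2 - t'| * (a s' + a p.1) := by gcongr; linarith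
    constructor <;> linarith
  · exact ((ha.isClassKInf_id_add_mul ht).inverse fun y hy => hβ y t hy ht).1
  · intro t ht t' ht' htt'
    by_contra! hc
    have h := hβ s t hs ht
    have h' := hβ s t' hs ht'
    have h1 := ha.2.1.monotoneOn h.1 h'.1 hc.le
    have ht : 0 ≤ t := ht
    have := mul_le_mul htt' h1 (ha.nonneg h.1) (ht.trans htt')
    linarith
  · rw [Metric.tendsto_atTop]
    intro e he
    have hae := ha.pos he
    refine ⟨(s + 1) / a e, fun t ht => ?_⟩
    have ht0 : 0 ≤ t := le_trans (by positivity) ht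
    have h := hβ s t hs ht0
    rw [Real.dist_0_eq_abs, abs_of_nonneg h.1]
    by_contra! hc
    have h1 := mul_le_mul_of_nonneg_left (ha.2.1.monotoneOn he.le h.1 hc) ht0
    rw [ge_iff_le, div_le_iff₀ hae] at ht
    linarith [h.1]

lemma PosDefFun.nonneg {n : ℕ} {V : Vec n → ℝ} (hV : PosDefFun V) (y : Vec n) : 0 ≤ V y := by
  rcases eq_or_ne y 0 with rfl | h
  · exact hV.1.ge
  · exact (hV.2 y h).le

/-- For positive definite, radially unbounded, continuous `V` and `Q` there is a class `K_∞`
function `a` with `a ∘ V ≤ Q`. -/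
theorem exists_isClassKInf_comp_le {n : ℕ} {V Q : Vec n → ℝ} (hVc : Continuous V)
    (hQc : Continuous Q) (hV : PosDefFun V) (hQ : PosDefFun Q) (hQr : RadiallyUnbounded Q) :
    ∃ a : ℝ → ℝ, IsClassKInf a ∧ ∀ y, a (V y) ≤ Q y := by
  -- The infimum of `Q` over `{V ≥ v}` need not be continuous in `v`. Replacing the constraint by
  -- the penalty `(v - V)⁺` makes the infimum 1-Lipschitz, and taking `v = V y` still bounds it by
  -- `Q y`.
  let h : ℝ → Vec n → ℝ := fun v y => Q y + max (v - V y) 0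
  have hh0 : ∀ v y, 0 ≤ h v y := fun v y => add_nonneg (hQ.nonneg y) (le_max_right _ _)
  have hbdd : ∀ v, BddBelow (range (h v)) := fun v => ⟨0, by rintro _ ⟨y, rfl⟩; exact hh0 v y⟩
  let a₀ : ℝ → ℝ := fun v => ⨅ y, h v y
  have ha₀le : ∀ v y, a₀ v ≤ h v y := fun v y => ciInf_le (hbdd v) y
  have ha₀nn : ∀ v, 0 ≤ a₀ v := fun v => le_ciInf (hh0 v)
  have hmono : Monotone a₀ := fun v w hvw => le_ciInf fun y =>
    (ha₀le v y).trans (by simp only [h]; gcongr)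
  have hlip : ∀ v w, a₀ v - a₀ w ≤ |v - w| := by
    intro v w
    have : a₀ v - |v - w| ≤ a₀ w := le_ciInf fun y => by
      have h1 := ha₀le v y
      have h2 : max (v - V y) 0 ≤ max (w - V y) 0 + |v - w| := by
        refine max_le ?_ (by positivity)
        have := le_max_left (w - V y) 0
        linarith [le_abs_self (v - w)]
      simp only [h] at h1 ⊢
      linarith
    linarith
  have hcont : Continuous a₀ := (LipschitzWith.of_dist_le_mul (K := 1) fun v w => by
    rw [Real.dist_eq, Real.dist_eq, NNReal.coe_one, one_mul, abs_le]
    have h1 := hlip v w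
    have h2 := hlip w v
    rw [abs_sub_comm] at h2
    constructor <;> linarith).continuous
  have hQbdd : ∀ M : ℝ, 0 < M → ∃ B, ∀ y, Q y ≤ M → V y ≤ B := fun M hM => by
    obtain ⟨B, hB⟩ := (hQr M hM).exists_bound_of_continuousOn hVc.continuousOn
    exact ⟨B, fun y hy => (Real.le_norm_self _).trans (hB y hy)⟩
  have hpos : ∀ v, 0 < v → 0 < a₀ v := by
    intro v hv
    have hcp : IsCompact {y | Q y ≤ 1} := hQr 1 one_pos
    have hhc : Continuous (h v) := by simp only [h]; fun_prop
    obtain ⟨y₀, hy₀, hmin⟩ := hcp.exists_isMinOn ⟨0, by simp [hQ.1]⟩ hhc.continuousOn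
    have hpy : ∀ y, 0 < h v y := fun y => by
      rcases eq_or_ne y 0 with rfl | hy
      · simp only [h, hQ.1, hV.1]; simpa using hv
      · exact add_pos_of_pos_of_nonneg (hQ.2 y hy) (le_max_right _ _)
    refine lt_of_lt_of_le (lt_min (hpy y₀) one_pos) (le_ciInf fun y => ?_)
    by_cases hy : Q y ≤ 1
    · exact (min_le_left _ _).trans (hmin hy)
    · refine (min_le_right _ _).trans ?_
      have := le_max_right (v - V y) 0
      simp only [h]; linarith
  have htop : Tendsto a₀ atTop atTop := by
    refine tendsto_atTop.2 fun M => ?_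
    -- Either `Q` is large, or `V ≤ B` and the penalty is at least `M`.
    obtain ⟨B, hB⟩ := hQbdd (max M 1) (by positivity)
    filter_upwards [eventually_ge_atTop (B + M)] with v hv
    refine le_ciInf fun y => ?_
    by_cases hy : Q y ≤ max M 1
    · have := hB y hy
      have h1 := le_max_left (v - V y) 0
      have := hQ.nonneg y
      simp only [h]; linarith
    · push Not at hy
      have := le_max_right (v - V y) 0
      have := le_max_left M 1
      simp only [h]; linarith
  have ha₀V : ∀ y, a₀ (V y) ≤ Q y := fun y => (ha₀le (V y) y).trans (by simp [h])
  have hr1 : ∀ v : ℝ, 0 ≤ v → v / (1 + v) ≤ 1 := fun v hv => by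
    rw [div_le_one (by linarith)]; linarith
  have hrmono : ∀ v w : ℝ, 0 ≤ v → v < w → v / (1 + v) < w / (1 + w) := fun v w hv hw => by
    rw [div_lt_div_iff₀ (by linarith) (by linarith)]; nlinarith
  -- The factor `v/(1+v)` upgrades monotone to strictly monotone and gives the value 0 at 0. It is
  -- at most 1, and at least 1/2 for `v ≥ 1`.
  refine ⟨fun v => a₀ v * (v / (1 + v)), ⟨⟨?_, ?_, by simp⟩, ?_⟩, fun y => ?_⟩
  · refine hcont.continuousOn.mul (continuousOn_id.div (by fun_prop) fun v hv => ?_)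
    have : (0 : ℝ) ≤ v := hv
    linarith
  · intro v hv w hw hvw
    have hv' : (0 : ℝ) ≤ v := hv
    have hw' : 0 < w := hv'.trans_lt hvw
    have h1 := hrmono v w hv' hvw
    calc a₀ v * (v / (1 + v)) ≤ a₀ w * (v / (1 + v)) := by gcongr; exact hmono hvw.le
      _ < a₀ w * (w / (1 + w)) := by gcongr; exact hpos w hw'
  · refine tendsto_atTop_mono' _ ?_ (htop.atTop_mul_const (show (0 : ℝ) < 1 / 2 by norm_num))
    filter_upwards [eventually_ge_atTop 1] with v hv
    refine mul_le_mul_of_nonneg_left ?_ (ha₀nn v)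
    rw [div_le_div_iff₀ (by norm_num) (by linarith)]; linarith
  · calc a₀ (V y) * (V y / (1 + V y)) ≤ a₀ (V y) * 1 := by
          gcongr
          · exact ha₀nn _
          · exact hr1 _ (hV.nonneg y)
      _ ≤ Q y := by rw [mul_one]; exact ha₀V y

end ComparisonFunctions

/-! ### Differential inequalities in integral form -/

section Comparison

/-- Fencing for integral inequalities: if `v` grows at most like `∫ h` with `h` continuous, and
`h < B'` wherever `v = B`, then `v` stays below `B`. -/
theorem le_of_sub_le_integral {v h B B' : ℝ → ℝ} {T : ℝ} (hv : ContinuousOn v (Icc 0 T))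
    (hh : ContinuousOn h (Icc 0 T))
    (hvh : ∀ s t, 0 ≤ s → s ≤ t → t ≤ T → v t - v s ≤ ∫ τ in s..t, h τ)
    (h0 : v 0 ≤ B 0) (hB : ∀ t, HasDerivAt B (B' t) t)
    (hlt : ∀ t ∈ Ico 0 T, v t = B t → h t < B' t) : ∀ t ∈ Icc 0 T, v t ≤ B t := by
  -- By right continuity of `h`, the integral inequality bounds the right difference quotients of
  -- `v` at `x` by anything above `h x`.
  refine fun t ht => image_le_of_liminf_slope_right_lt_deriv_boundary (f' := h) hv ?_ h0 hB hlt ht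
  intro x hx r hr
  refine Eventually.frequently ?_
  have hxT : x < T := hx.2
  have hcw : Tendsto h (𝓝[>] x) (𝓝 (h x)) :=
    ((hh x ⟨hx.1, hx.2.le⟩).mono_of_mem_nhdsWithin
      (mem_of_superset (Ioc_mem_nhdsGT hxT) fun y hy => ⟨hx.1.trans hy.1.le, hy.2⟩)).tendsto
  obtain ⟨r', hr'1, hr'2⟩ := exists_between hr
  have hev := hcw.eventually_lt_const hr'1
  rw [eventually_iff, mem_nhdsGT_iff_exists_Ioc_subset] at hev
  obtain ⟨u, hu, hsub⟩ := hev
  filter_upwards [Ioc_mem_nhdsGT (lt_min hu hxT)] with z hz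
  have hxz : x < z := hz.1
  have hzT : z ≤ T := hz.2.trans (min_le_right _ _)
  have hint : IntervalIntegrable h volume x z :=
    (hh.mono (by rw [uIcc_of_le hxz.le]; exact Icc_subset_Icc hx.1 hzT)).intervalIntegrable
  have h1 := hvh x z hx.1 hxz.le hzT
  have h2 : ∫ τ in x..z, h τ ≤ ∫ _τ in x..z, r' := by
    refine intervalIntegral.integral_mono_on_of_le_Ioo hxz.le hint (by simp) fun τ hτ => ?_
    exact le_of_lt (hsub ⟨hτ.1, (hτ.2.le.trans hz.2).trans (min_le_left _ _)⟩)
  rw [intervalIntegral.integral_const, smul_eq_mul] at h2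
  rw [slope_def_field, div_lt_iff₀ (sub_pos.2 hxz)]
  nlinarith [sub_pos.2 hxz]

/-- Input-to-state estimate for `v̇ ≤ -a(v) + c`. -/
theorem le_classKL_add_of_sub_le_integral {a v : ℝ → ℝ} {β : ℝ → ℝ → ℝ} {c k T : ℝ}
    (ha : IsClassK a)
    (hβ : ∀ s t, 0 ≤ s → 0 ≤ t → 0 ≤ β s t ∧ β s t + t * (a (β s t) / 2) = s)
    (hβc : IsClassKL β)
    (hk : 0 ≤ k) (hak : 2 * c ≤ a k)
    (hv0 : ∀ t ∈ Icc 0 T, 0 ≤ v t) (hv : ContinuousOn v (Icc 0 T))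
    (hvi : ∀ s t, 0 ≤ s → s ≤ t → t ≤ T → v t - v s ≤ ∫ τ in s..t, (-a (v τ) + c)) :
    ∀ t ∈ Icc 0 T, v t ≤ β (v 0) t + k := by
  intro t ht
  have h00 : 0 ≤ v 0 := hv0 0 ⟨le_rfl, ht.1.trans ht.2⟩
  -- Taking `s > v 0` makes `r = β s t` positive, hence the contact inequality strict; afterwards
  -- `s` decreases to `v 0`.
  have key : ∀ s, v 0 < s → v t ≤ β s t + k := by
    intro s hs
    have hs0 : 0 < s := h00.trans_lt hs
    obtain ⟨hr0, hr⟩ := hβ s t hs0.le ht.1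
    have hrpos : 0 < β s t := by
      refine hr0.lt_of_ne fun h => ?_
      rw [← h, ha.2.2] at hr
      linarith
    set r := β s t with hrd
    have hsub : Icc 0 t ⊆ Icc 0 T := Icc_subset_Icc le_rfl ht.2
    -- The fence is a straight line from `s + k` down to `r + k` at time `t`. On contact before `t`,
    -- `v ≥ r + k`, so `a(v) > a(k) ≥ 2c` and `-a(v) + c < -a(v)/2 ≤ -a(r)/2`, the slope of the
    -- fence.
    have := le_of_sub_le_integral (T := t) (v := v) (h := fun τ => -a (v τ) + c)
      (B := fun τ => s - τ * (a r / 2) + k) (B' := fun _ => -(a r / 2)) (hv.mono hsub)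
      ((ha.1.comp (hv.mono hsub) fun τ hτ => hv0 τ (hsub hτ)).neg.add continuousOn_const)
      (fun s t h1 h2 h3 => hvi s t h1 h2 (h3.trans ht.2)) (by linarith)
      (fun τ => by
        simpa using (((hasDerivAt_id τ).mul_const (a r / 2)).const_sub s).add_const k)
      (fun τ hτ heq => by
        have h1 : τ * (a r / 2) ≤ t * (a r / 2) := by
          have := ha.nonneg hr0
          gcongr; exact hτ.2.le
        have h2 : r + k ≤ v τ := by rw [heq]; linarith
        have h3 : a r ≤ a (v τ) := ha.2.1.monotoneOn hr0
          (hv0 τ (hsub ⟨hτ.1, hτ.2.le⟩)) (by linarith)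
        have h4 : a k < a (v τ) := ha.2.1 hk
          (hv0 τ (hsub ⟨hτ.1, hτ.2.le⟩)) (by linarith)
        linarith) t ⟨ht.1, le_rfl⟩
    linarith
  have hcont : Tendsto (fun s => β s t + k) (𝓝[>] (v 0)) (𝓝 (β (v 0) t + k)) :=
    ((((hβc.2.1 t ht.1).1 (v 0) h00).mono fun s hs => h00.trans (le_of_lt hs)).tendsto).add_const k
  exact ge_of_tendsto hcont (eventually_mem_of_tendsto_nhdsWithin tendsto_id |>.mono
    fun s hs => key s hs)

end Comparison

/-! ### Chain rule along Lipschitz curves -/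

section ChainRule

/-- An upper bound for the growth of a `C¹` function along an absolutely continuous curve with
essentially bounded velocity. -/
theorem comp_sub_le_integral {n : ℕ} {W : Vec n → ℝ} (hW : ContDiff ℝ 1 W)
    {G y : ℝ → Vec n} {H : ℝ → ℝ} {y₀ : Vec n} {T M : ℝ}
    (hGi : ∀ t ∈ Icc 0 T, IntervalIntegrable G volume 0 t)
    (hGM : ∀ᵐ τ, τ ∈ Icc 0 T → ‖G τ‖ ≤ M)
    (hy : ∀ t ∈ Icc 0 T, y t = y₀ + ∫ τ in (0 : ℝ)..t, G τ)
    (hyc : ContinuousOn y (Icc 0 T)) (hH : ContinuousOn H (Icc 0 T))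
    (hle : ∀ᵐ τ, τ ∈ Icc 0 T → fderiv ℝ W (y τ) (G τ) ≤ H τ)
    {s t : ℝ} (hs : 0 ≤ s) (hst : s ≤ t) (ht : t ≤ T) :
    W (y t) - W (y s) ≤ ∫ τ in s..t, H τ := by
  -- Bounded velocity makes `y` Lipschitz, so `W ∘ y` is Lipschitz and is the integral of its almost
  -- everywhere derivative.
  have hylip : LipschitzOnWith M.toNNReal y (Icc 0 T) := by
    refine LipschitzOnWith.of_dist_le_mul fun a ha c hc => ?_
    rw [dist_eq_norm, hy a ha, hy c hc, add_sub_add_left_eq_sub,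
      intervalIntegral.integral_interval_sub_left (hGi a ha) (hGi c hc), Real.dist_eq]
    have := intervalIntegral.norm_integral_le_of_norm_le_const_ae (a := c) (b := a) (f := G)
      (C := max M 0) (by
        filter_upwards [hGM] with τ hτ hm
        have hsub : uIoc c a ⊆ Icc 0 T := by
          refine uIoc_subset_uIcc.trans ?_
          exact (ordConnected_Icc.uIcc_subset hc ha)
        exact (hτ (hsub hm)).trans (le_max_left _ _))
    simpa using this
  have hsub : Icc s t ⊆ Icc 0 T := Icc_subset_Icc hs ht
  have hcomp : IsCompact (y '' Icc 0 T) := isCompact_Icc.image_of_continuousOn hyc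
  obtain ⟨K, hK⟩ := LocallyLipschitzOn.exists_lipschitzOnWith_of_compact hcomp
    hW.locallyLipschitz.locallyLipschitzOn
  have hAC : AbsolutelyContinuousOnInterval (W ∘ y) s t := by
    refine LipschitzOnWith.absolutelyContinuousOnInterval
      (K := K * M.toNNReal) ?_
    rw [uIcc_of_le hst]
    exact (hK.comp hylip (mapsTo_image _ _)).mono hsub
  have hFTC : ∫ τ in s..t, deriv (W ∘ y) τ = W (y t) - W (y s) := hAC.integral_deriv_eq_sub
  rw [← hFTC]
  have h0 : (0 : ℝ) ≤ T := hs.trans (hst.trans ht)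
  have hHi : IntervalIntegrable H volume s t :=
    (hH.mono (by rwa [uIcc_of_le hst])).intervalIntegrable
  refine intervalIntegral.integral_mono_ae_restrict hst hAC.intervalIntegrable_deriv hHi ?_
  have hae := (hGi T ⟨h0, le_rfl⟩).ae_hasDerivAt_integral
  refine (ae_restrict_iff' measurableSet_Icc).2 ?_
  have n0 : ∀ᵐ τ : ℝ, τ ≠ 0 := by simp [ae_iff, measure_singleton]
  have nT : ∀ᵐ τ : ℝ, τ ≠ T := by simp [ae_iff, measure_singleton]
  filter_upwards [hae, hle, n0, nT] with τ h1 h2 hne0 hneT hm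
  have hm' : τ ∈ Icc 0 T := hsub hm
  have hopen : Ioo 0 T ∈ 𝓝 τ :=
    Ioo_mem_nhds (hm'.1.lt_of_ne' hne0) (hm'.2.lt_of_ne hneT)
  have hder : HasDerivAt y (G τ) τ := by
    have h3 := (h1 (by rwa [uIcc_of_le h0]) 0 (by simp)).const_add y₀
    refine h3.congr_of_eventuallyEq ?_
    filter_upwards [hopen] with r hr
    exact hy r ⟨hr.1.le, hr.2.le⟩
  have hWd : HasFDerivAt W (fderiv ℝ W (y τ)) (y τ) :=
    (hW.differentiable one_ne_zero _).hasFDerivAt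
  rw [(hWd.comp_hasDerivAt τ hder).deriv]
  exact h2 hm'

end ChainRule

/-! ### The dissipation inequality and monotonicity of `χ` -/

section Dissipation

lemma mul_le_sq_add_sq_div {k : ℝ} (hk : 0 < k) (x y : ℝ) :
    x * y ≤ k * x ^ 2 + y ^ 2 / (4 * k) := by
  have : k * x ^ 2 + y ^ 2 / (4 * k) - x * y = (2 * k * x - y) ^ 2 / (4 * k) := by
    field_simp; ring
  have h2 : 0 ≤ (2 * k * x - y) ^ 2 / (4 * k) := by positivity
  linarith

/-- High-gain terms are dominated by the damping up to a residual that vanishes for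
`c ≥ 1 / B`. -/
lemma sub_damping_le {C c b B X : ℝ} (hC : 0 < C) (hc : 0 < c) (hB : 0 < B) (hb : B ≤ b)
    (hX : 0 ≤ X) :
    X - b * (C * c * X ^ 2 + c * X) ≤ B * (max (1 / B - c) 0) ^ 2 / (4 * C * c) := by
  set u := max (1 / B - c) 0 with hu
  -- The linear damping leaves `X - BcX ≤ BuX`, and Young's inequality pays for `uX` with the
  -- quadratic damping.
  have h1 : 1 - B * c ≤ B * u := by
    have := mul_le_mul_of_nonneg_left (le_max_left (1 / B - c) 0) hB.le
    rw [mul_sub, mul_one_div_cancel hB.ne'] at this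
    exact this
  have h2 : B * (C * c * X ^ 2 + c * X) ≤ b * (C * c * X ^ 2 + c * X) := by gcongr
  have h3 := mul_le_sq_add_sq_div (mul_pos hC hc) X u
  have h4 : B * u ^ 2 / (4 * C * c) = B * (u ^ 2 / (4 * (C * c))) := by ring
  rw [h4]
  nlinarith [mul_le_mul_of_nonneg_left h1 hX, mul_le_mul_of_nonneg_left h3 hB.le]

/-- The contribution of one input channel. -/
lemma channel_le {C c b B D Θ M σ w s δ f a l j : ℝ} (hC : 0 < C) (hc : 0 < c) (hB : 0 < B)
    (hb : B ≤ b) (hM : 0 < M) (hs : 0 ≤ s) (hf : 0 ≤ f)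
    (hl : |l| ≤ f * Θ) (hj : |j| ≤ a * D) :
    σ * (δ * w) + s * w ^ 2
      + w * (b * (-(C * c * s ^ 2 * w ^ 2 + c * s
          + C ^ 3 * c ^ 3 * (f ^ 2 + a ^ 2 + c ^ 2 * M + δ ^ 2) ^ 2 * w ^ 2
          + C * c ^ 2 * (f ^ 2 + a ^ 2 + c ^ 2 * M + δ ^ 2)) * w) + l + j)
      ≤ f ^ 2 / (4 * C * c * M)
        + (D ^ 2 + σ ^ 2 + (max (Θ - c) 0) ^ 2 + 2 * B * (max (1 / B - c) 0) ^ 2)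
          / (4 * C * c) := by
  set P := f ^ 2 + a ^ 2 + c ^ 2 * M + δ ^ 2 with hP
  have hP0 : 0 ≤ P := by positivity
  have hk : 0 < C * c := mul_pos hC hc
  -- These two values of `X` account for the four terms of the gain: the first cancels `s w²`, the
  -- second makes `C c P w²` available for the cross terms below.
  have e1 := sub_damping_le hC hc hB hb (X := s * w ^ 2) (by positivity)
  have e2 := sub_damping_le hC hc hB hb (X := C * c * P * w ^ 2) (by positivity)
  have e3 := mul_le_sq_add_sq_div hk (δ * w) σ
  have e4 := mul_le_sq_add_sq_div hk (a * |w|) D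
  have e5 := mul_le_sq_add_sq_div hk (f * |w|) (max (Θ - c) 0)
  have e6 := mul_le_sq_add_sq_div (show 0 < C * c * M by positivity) (c * |w|) f
  -- Splitting `Θ ≤ (Θ - c)⁺ + c`: the excess is paid by `f²` in `P`, the known part by `c² M`.
  have e7 : w * l ≤ (f * |w|) * (max (Θ - c) 0) + (c * |w|) * f := by
    calc w * l ≤ |w| * |l| := by rw [← abs_mul]; exact le_abs_self _
      _ ≤ |w| * (f * Θ) := by gcongr
      _ ≤ |w| * (f * (max (Θ - c) 0 + c)) := by
          gcongr; linarith [le_max_left (Θ - c) 0]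
      _ = _ := by ring
  have e8 : w * j ≤ (a * |w|) * D := by
    calc w * j ≤ |w| * |j| := by rw [← abs_mul]; exact le_abs_self _
      _ ≤ |w| * (a * D) := by gcongr
      _ = _ := by ring
  have hw2 : |w| ^ 2 = w ^ 2 := sq_abs w
  have e6' : (c * |w|) * f ≤ C * c * (c ^ 2 * M * w ^ 2) + f ^ 2 / (4 * C * c * M) := by
    have : C * c * M * (c * |w|) ^ 2 + f ^ 2 / (4 * (C * c * M))
        = C * c * (c ^ 2 * M * w ^ 2) + f ^ 2 / (4 * C * c * M) := by
      rw [mul_pow, hw2]; ring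
    rw [this] at e6
    linarith
  rw [mul_pow, hw2] at e4 e5
  have hsplit : (D ^ 2 + σ ^ 2 + (max (Θ - c) 0) ^ 2 + 2 * B * (max (1 / B - c) 0) ^ 2)
      / (4 * C * c) = D ^ 2 / (4 * (C * c)) + σ ^ 2 / (4 * (C * c))
        + (max (Θ - c) 0) ^ 2 / (4 * (C * c)) + B * (max (1 / B - c) 0) ^ 2 / (4 * C * c)
        + B * (max (1 / B - c) 0) ^ 2 / (4 * C * c) := by ring
  rw [hsplit]
  have hPw : C * c * P * w ^ 2 = C * c * (f ^ 2 * w ^ 2) + C * c * (a ^ 2 * w ^ 2)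
      + C * c * (c ^ 2 * M * w ^ 2) + C * c * (δ * w) ^ 2 := by rw [hP]; ring
  have hlhs : σ * (δ * w) + s * w ^ 2
      + w * (b * (-(C * c * s ^ 2 * w ^ 2 + c * s
          + C ^ 3 * c ^ 3 * P ^ 2 * w ^ 2 + C * c ^ 2 * P) * w) + l + j)
      = (s * w ^ 2 - b * (C * c * (s * w ^ 2) ^ 2 + c * (s * w ^ 2)))
        + (C * c * P * w ^ 2 - b * (C * c * (C * c * P * w ^ 2) ^ 2 + c * (C * c * P * w ^ 2)))
        + (δ * w * σ + w * l + w * j) - C * c * P * w ^ 2 := by ring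
  rw [hlhs]
  linarith

variable {n m p q : ℕ} {S : Plant n m p q} {L : LyapData n m} {K : Gains}

/-- The dissipation inequality for the closed loop. -/
theorem lieD_plantField_le (hA : AssumptionA S L) (hB : AssumptionB S L) (hK : K.Admissible)
    {D Θ B : ℝ} (hB0 : 0 < B) (y : Vec n) (z : ℝ) {d : Vec q} {θ : Vec p} {b : Vec m}
    (hd : ‖d‖ ≤ D) (hθ : ‖θ‖ ≤ Θ) (hb : ∀ i, B ≤ b i) :
    fderiv ℝ L.V y (plantField S L K y z d θ b)
      ≤ -L.Q y / 2 + χ L K D Θ B (Real.exp z) := by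
  obtain ⟨-, -, hC, hκ, hCκ⟩ := hK
  set c := K.κ + Real.exp z with hcdef
  have hc : 0 < c := by positivity
  have hκc : K.κ ≤ c := by rw [hcdef]; linarith [Real.exp_pos z]
  have hM := hB.μ_pos y
  have hchan : ∀ i, L.σ * (L.δ i y * lieD L.V (S.g i) y) + L.s i y * lieD L.V (S.g i) y ^ 2
      + lieD L.V (S.g i) y * (b i * control S L K i y z + inner ℝ (S.φ i y) θ
        + inner ℝ (S.A i y) d)
      ≤ ‖S.φ i y‖ ^ 2 / (4 * K.C * c * L.μ y)
        + (D ^ 2 + L.σ ^ 2 + (max (Θ - c) 0) ^ 2 + 2 * B * (max (1 / B - c) 0) ^ 2)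
          / (4 * K.C * c) := fun i => by
    have := channel_le (C := K.C) (c := c) (σ := L.σ) (w := lieD L.V (S.g i) y) (δ := L.δ i y)
      (s := L.s i y) (a := ‖S.A i y‖) (D := D) (Θ := Θ) hC hc hB0 (hb i) hM (hA.s_nonneg i y) (norm_nonneg (S.φ i y))
      ((abs_real_inner_le_norm (S.φ i y) θ).trans (by gcongr))
      ((abs_real_inner_le_norm (S.A i y) d).trans (by gcongr))
    simpa only [control, r, P, hcdef] using this
  have hsum := Finset.sum_le_sum fun i (_ : i ∈ Finset.univ) => hchan i
  have hlin : fderiv ℝ L.V y (plantField S L K y z d θ b) = lieD L.V S.f y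
      + ∑ i, lieD L.V (S.g i) y * (b i * control S L K i y z + inner ℝ (S.φ i y) θ
        + inner ℝ (S.A i y) d) := by
    simp only [plantField, map_add, map_sum, map_smul, smul_eq_mul, lieD]
    congr 1
    exact Finset.sum_congr rfl fun i _ => mul_comm _ _
  have hdec := hA.decrease y
  have hgrow : ∑ i, ‖S.φ i y‖ ^ 2 / (4 * K.C * c * L.μ y)
      ≤ L.Q y / 2 + 2 * K.C * K.κ * L.Λ / (4 * K.C * c) := by
    rw [← Finset.sum_div]
    have hΛ := hB.Λ_nonneg
    have hQ := hA.posDef_Q.nonneg y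
    -- Here `2Cκ ≥ 1` enters, since `c ≥ κ`. It is used again below in the form `Λ ≤ 2CκΛ`.
    have h4 : 2 ≤ 4 * K.C * c := by nlinarith
    calc (∑ i, ‖S.φ i y‖ ^ 2) / (4 * K.C * c * L.μ y)
        ≤ L.μ y * (L.Q y + L.Λ) / (4 * K.C * c * L.μ y) := by
          gcongr; exact hB.growth y
      _ = L.Q y / (4 * K.C * c) + L.Λ / (4 * K.C * c) := by field_simp
      _ ≤ L.Q y / 2 + 2 * K.C * K.κ * L.Λ / (4 * K.C * c) := by
          gcongr
          nlinarith
  have hχ : χ L K D Θ B (Real.exp z) = 2 * K.C * K.κ * L.Λ / (4 * K.C * c)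
      + m * ((D ^ 2 + L.σ ^ 2 + (max (Θ - c) 0) ^ 2 + 2 * B * (max (1 / B - c) 0) ^ 2)
          / (4 * K.C * c)) := by
    simp only [χ, sub_sub, ← hcdef]
    ring
  rw [Finset.sum_add_distrib, Finset.sum_add_distrib, Finset.sum_add_distrib, ← Finset.mul_sum,
    Finset.sum_const, Finset.card_univ, Fintype.card_fin, nsmul_eq_mul] at hsum
  rw [hlin, hχ]
  linarith

lemma χ_nonneg (hB : AssumptionB S L) (hK : K.Admissible) (D Θ : ℝ) {B s₄ : ℝ} (hB0 : 0 < B)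
    (hs : 0 ≤ s₄) : 0 ≤ χ L K D Θ B s₄ := by
  obtain ⟨-, -, hC, hκ, -⟩ := hK
  have := hB.Λ_nonneg
  unfold χ
  positivity

/-- `(κ + s₄) χ` is nonincreasing in `s₄`. -/
lemma χ_le_mul_χ_div (hK : K.Admissible) (D Θ : ℝ) {B s t : ℝ} (hB0 : 0 < B)
    (hs : 0 ≤ s) (hst : s ≤ t) :
    χ L K D Θ B t ≤ (K.κ + s) * χ L K D Θ B s / (K.κ + t) := by
  obtain ⟨-, -, hC, hκ, -⟩ := hK
  have ht : 0 ≤ t := hs.trans hst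
  have h : (K.κ + s) * χ L K D Θ B s / (K.κ + t)
      = ((m : ℝ) * D ^ 2 + m * L.σ ^ 2 + m * (max (Θ - K.κ - s) 0) ^ 2
      + 2 * K.C * K.κ * L.Λ
      + 2 * m * B * (max (1 / B - K.κ - s) 0) ^ 2) / (4 * K.C * (K.κ + t)) := by
    unfold χ
    have : K.κ + s ≠ 0 := by positivity
    have : K.κ + t ≠ 0 := by positivity
    field_simp
  rw [h]
  unfold χ
  gcongr

lemma χ_anti (hB : AssumptionB S L) (hK : K.Admissible) (D Θ : ℝ) {B s t : ℝ} (hB0 : 0 < B)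
    (hs : 0 ≤ s) (hst : s ≤ t) : χ L K D Θ B t ≤ χ L K D Θ B s := by
  have hκ := hK.2.2.2.1
  refine (χ_le_mul_χ_div hK D Θ hB0 hs hst).trans ?_
  rw [div_le_iff₀ (by linarith), mul_comm]
  gcongr
  exact χ_nonneg hB hK D Θ hB0 hs

end Dissipation

/-! ### Regularity of the closed loop -/

section Regularity

variable {n m p q : ℕ} {S : Plant n m p q} {L : LyapData n m} {K : Gains}

/-- The closed-loop right-hand side as a function of the state `(y, z)` and the input
`(d, θ, b)`. -/
def closedLoopField (S : Plant n m p q) (L : LyapData n m) (K : Gains)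
    (x : (Vec n × ℝ) × (Vec q × Vec p × Vec m)) : Vec n × ℝ :=
  (plantField S L K x.1.1 x.1.2 x.2.1 x.2.2.1 x.2.2.2, adaptField L K x.1.1 x.1.2)

lemma contDiff_lieD {V : Vec n → ℝ} {h : Vec n → Vec n} (hV : ContDiff ℝ ∞ V)
    (hh : ContDiff ℝ ∞ h) : ContDiff ℝ ∞ (lieD V h) :=
  (hV.fderiv_right (m := ∞) (by simp)).clm_apply hh

lemma locallyLipschitz_closedLoopField (hS : S.Regular) (hA : AssumptionA S L)
    (hB : AssumptionB S L) (hΓ : 0 ≤ K.Γ) :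
    LocallyLipschitz (closedLoopField S L K) := by
  refine LocallyLipschitz.prodMk ?_ ?_
  · refine ContDiff.locallyLipschitz (𝕂 := ℝ) ?_
    refine ContDiff.of_le (n := ∞) ?_ (by exact_mod_cast le_top)
    have hy : ContDiff ℝ ∞ (fun x : (Vec n × ℝ) × (Vec q × Vec p × Vec m) => x.1.1) := by fun_prop
    have hz : ContDiff ℝ ∞ (fun x : (Vec n × ℝ) × (Vec q × Vec p × Vec m) => x.1.2) := by fun_prop
    have hκz : ContDiff ℝ ∞ (fun x : (Vec n × ℝ) × (Vec q × Vec p × Vec m) =>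
      K.κ + Real.exp x.1.2) := by fun_prop
    have hs := fun i => (hA.smooth_s i).comp hy
    have hδ := fun i => (hA.smooth_δ i).comp hy
    have hμ := hB.smooth_μ.comp hy
    have hφ := fun i => (hS.smooth_φ i).comp hy
    have hAi := fun i => (hS.smooth_A i).comp hy
    have hg := fun i => (hS.smooth_g i).comp hy
    have hf := hS.smooth_f.comp hy
    have hw := fun i => (contDiff_lieD hA.smooth_V (hS.smooth_g i)).comp hy
    simp only [Function.comp_def] at hs hδ hμ hφ hAi hg hf hw
    have hP : ∀ i, ContDiff ℝ ∞ (fun x : (Vec n × ℝ) × (Vec q × Vec p × Vec m) =>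
        P S L K i x.1.1 x.1.2) := fun i => by
      unfold P
      exact ((((hφ i).norm_sq ℝ).add ((hAi i).norm_sq ℝ)).add ((hκz.pow 2).mul hμ)).add
        ((hδ i).pow 2)
    have hr : ∀ i, ContDiff ℝ ∞ (fun x : (Vec n × ℝ) × (Vec q × Vec p × Vec m) =>
        r S L K i x.1.1 x.1.2) := fun i => by
      unfold r
      exact (((((contDiff_const.mul hκz).mul ((hs i).pow 2)).mul ((hw i).pow 2)).add
        (hκz.mul (hs i))).add (((contDiff_const.mul (hκz.pow 3)).mul ((hP i).pow 2)).mul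
          ((hw i).pow 2))).add ((contDiff_const.mul (hκz.pow 2)).mul (hP i))
    have hb : ∀ i, ContDiff ℝ ∞ (fun x : (Vec n × ℝ) × (Vec q × Vec p × Vec m) =>
        x.2.2.2 i) := fun i => by fun_prop
    unfold plantField control
    refine hf.add (ContDiff.sum fun i _ => ?_)
    exact ((((hb i).mul ((hr i).neg.mul (hw i))).add
      ((hφ i).inner ℝ (by fun_prop))).add ((hAi i).inner ℝ (by fun_prop))).smul (hg i)
  -- The positive part is not smooth. Moving the nonnegative factor `Γ e^{-z}` inside it exhibits
  -- the field as the maximum of a smooth function and 0.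
  · have hsm : ContDiff ℝ ∞ (fun x : (Vec n × ℝ) × (Vec q × Vec p × Vec m) =>
        K.Γ * Real.exp (-x.1.2) * (L.V x.1.1 - K.ε)) := by
      have := hA.smooth_V
      fun_prop
    have := ((hsm.of_le (m := 1) (by exact_mod_cast le_top)).locallyLipschitz).max_const 0
    refine (congrArg LocallyLipschitz (funext fun x => ?_)).mpr this
    change K.Γ * Real.exp (-x.1.2) * max (L.V x.1.1 - K.ε) 0 = _
    rw [mul_max_of_nonneg _ _ (by positivity), mul_zero]

lemma IsSolutionOn.isIntegralSol {d : ℝ → Vec q} {θ : ℝ → Vec p} {b : ℝ → Vec m}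
    {y₀ : Vec n} {z₀ : ℝ} {I : Set ℝ} {y : ℝ → Vec n} {z : ℝ → ℝ}
    (h : IsSolutionOn S L K d θ b y₀ z₀ I y z) :
    IsIntegralSol (fun t x => closedLoopField S L K (x, (d t, θ t, b t))) (y₀, z₀) I
      (fun t => (y t, z t)) := by
  have hint : ∀ t ∈ I, IntervalIntegrable (fun τ =>
      closedLoopField S L K ((y τ, z τ), (d τ, θ τ, b τ))) volume 0 t := fun t ht =>
    ⟨(h.integrable_y t ht).1.prodMk (h.integrable_z t ht).1,
      (h.integrable_y t ht).2.prodMk (h.integrable_z t ht).2⟩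
  refine ⟨h.cont_y.prodMk h.cont_z, hint, fun t ht => ?_⟩
  have h1 := (ContinuousLinearMap.fst ℝ (Vec n) ℝ).intervalIntegral_comp_comm (hint t ht)
  have h2 := (ContinuousLinearMap.snd ℝ (Vec n) ℝ).intervalIntegral_comp_comm (hint t ht)
  refine Prod.ext ?_ ?_
  · exact (h.eq_y t ht).trans (congrArg (y₀ + ·) h1)
  · exact (h.eq_z t ht).trans (congrArg (z₀ + ·) h2)

lemma IsIntegralSol.isSolutionOn {d : ℝ → Vec q} {θ : ℝ → Vec p} {b : ℝ → Vec m}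
    {y₀ : Vec n} {z₀ : ℝ} {I : Set ℝ} {x : ℝ → Vec n × ℝ}
    (h : IsIntegralSol (fun t x => closedLoopField S L K (x, (d t, θ t, b t))) (y₀, z₀) I x) :
    IsSolutionOn S L K d θ b y₀ z₀ I (fun t => (x t).1) (fun t => (x t).2) := by
  have h1 := fun t ht =>
    (ContinuousLinearMap.fst ℝ (Vec n) ℝ).intervalIntegral_comp_comm (h.integrable t ht)
  have h2 := fun t ht =>
    (ContinuousLinearMap.snd ℝ (Vec n) ℝ).intervalIntegral_comp_comm (h.integrable t ht)
  exact ⟨continuous_fst.comp_continuousOn h.cont, continuous_snd.comp_continuousOn h.cont,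
    fun t ht => ⟨(h.integrable t ht).1.fst, (h.integrable t ht).2.fst⟩,
    fun t ht => ⟨(h.integrable t ht).1.snd, (h.integrable t ht).2.snd⟩,
    fun t ht => (congrArg Prod.fst (h.eq t ht)).trans (congrArg (y₀ + ·) (h1 t ht).symm),
    fun t ht => (congrArg Prod.snd (h.eq t ht)).trans (congrArg (z₀ + ·) (h2 t ht).symm)⟩

end Regularity

/-! ### A priori bounds for `V` and `z` -/

section APriori

variable {n m p q : ℕ} {S : Plant n m p q} {L : LyapData n m} {K : Gains}

/-- Essential bounds for the inputs of the closed loop. -/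
structure InputBounds (d : ℝ → Vec q) (θ : ℝ → Vec p) (b : ℝ → Vec m) (D Θ B M : ℝ) : Prop where
  meas : AEStronglyMeasurable (fun t => (d t, θ t, b t)) (volume.restrict (Ici 0))
  bdd : ∀ᵐ t ∂(volume.restrict (Ici (0 : ℝ))), ‖(d t, θ t, b t)‖ ≤ M
  d_le : ∀ᵐ t ∂(volume.restrict (Ici (0 : ℝ))), ‖d t‖ ≤ D
  θ_le : ∀ᵐ t ∂(volume.restrict (Ici (0 : ℝ))), ‖θ t‖ ≤ Θ
  B_pos : 0 < B
  b_ge : ∀ t, 0 ≤ t → ∀ i, B ≤ b t i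

lemma continuous_χ_exp (hK : K.Admissible) (D Θ B : ℝ) :
    Continuous fun z => χ L K D Θ B (Real.exp z) := by
  obtain ⟨-, -, hC, hκ, -⟩ := hK
  unfold χ
  refine Continuous.div (by fun_prop) (by fun_prop) fun z => ?_
  positivity

variable {d : ℝ → Vec q} {θ : ℝ → Vec p} {b : ℝ → Vec m} {D Θ B M : ℝ}
  {y₀ : Vec n} {z₀ T : ℝ} {y : ℝ → Vec n} {z : ℝ → ℝ}

lemma IsSolutionOn.mono {I J : Set ℝ} (h : IsSolutionOn S L K d θ b y₀ z₀ I y z) (hJ : J ⊆ I) :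
    IsSolutionOn S L K d θ b y₀ z₀ J y z :=
  ⟨h.cont_y.mono hJ, h.cont_z.mono hJ, fun t ht => h.integrable_y t (hJ ht),
    fun t ht => h.integrable_z t (hJ ht), fun t ht => h.eq_y t (hJ ht),
    fun t ht => h.eq_z t (hJ ht)⟩

lemma IsSolutionOn.z_sub_eq (h : IsSolutionOn S L K d θ b y₀ z₀ (Icc 0 T) y z) {s t : ℝ}
    (hs : 0 ≤ s) (hst : s ≤ t) (ht : t ≤ T) :
    z t - z s = ∫ τ in s..t, adaptField L K (y τ) (z τ) := by
  rw [h.eq_z t ⟨hs.trans hst, ht⟩, h.eq_z s ⟨hs, hst.trans ht⟩, add_sub_add_left_eq_sub,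
    intervalIntegral.integral_interval_sub_left (h.integrable_z t ⟨hs.trans hst, ht⟩)
      (h.integrable_z s ⟨hs, hst.trans ht⟩)]

lemma IsSolutionOn.z_mono (h : IsSolutionOn S L K d θ b y₀ z₀ (Icc 0 T) y z) (hΓ : 0 ≤ K.Γ)
    {s t : ℝ} (hs : 0 ≤ s) (hst : s ≤ t) (ht : t ≤ T) : z s ≤ z t := by
  have h1 := h.z_sub_eq hs hst ht
  have h2 : 0 ≤ ∫ τ in s..t, adaptField L K (y τ) (z τ) :=
    intervalIntegral.integral_nonneg hst fun τ _ => by unfold adaptField; positivity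
  linarith

lemma IsSolutionOn.z_zero (h : IsSolutionOn S L K d θ b y₀ z₀ (Icc 0 T) y z) (hT : 0 ≤ T) :
    z 0 = z₀ := by
  simpa using h.eq_z 0 ⟨le_rfl, hT⟩

lemma IsSolutionOn.y_zero (h : IsSolutionOn S L K d θ b y₀ z₀ (Icc 0 T) y z) (hT : 0 ≤ T) :
    y 0 = y₀ := by
  simpa using h.eq_y 0 ⟨le_rfl, hT⟩

lemma IsSolutionOn.cont_V (h : IsSolutionOn S L K d θ b y₀ z₀ (Icc 0 T) y z)
    (hA : AssumptionA S L) : ContinuousOn (fun τ => L.V (y τ)) (Icc 0 T) :=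
  hA.smooth_V.continuous.comp_continuousOn h.cont_y

lemma IsSolutionOn.cont_adapt (h : IsSolutionOn S L K d θ b y₀ z₀ (Icc 0 T) y z)
    (hA : AssumptionA S L) : ContinuousOn (fun τ => adaptField L K (y τ) (z τ)) (Icc 0 T) := by
  have h1 := h.cont_V hA
  have h2 := h.cont_z
  unfold adaptField
  exact (continuousOn_const.mul (Real.continuous_exp.comp_continuousOn h2.neg)).mul
    ((h1.sub continuousOn_const).sup continuousOn_const)

/-- Growth of `Ψ ∘ V` along solutions, for nondecreasing `Ψ` of class `C¹`. -/
theorem IsSolutionOn.comp_V_sub_le (h : IsSolutionOn S L K d θ b y₀ z₀ (Icc 0 T) y z)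
    (hS : S.Regular) (hA : AssumptionA S L) (hB : AssumptionB S L) (hK : K.Admissible)
    (hin : InputBounds d θ b D Θ B M) {Ψ ψ : ℝ → ℝ} (hΨ : ∀ v, HasDerivAt Ψ (ψ v) v)
    (hψ : Continuous ψ) (hψ0 : ∀ v, 0 ≤ ψ v) {s t : ℝ} (hs : 0 ≤ s) (hst : s ≤ t) (ht : t ≤ T) :
    Ψ (L.V (y t)) - Ψ (L.V (y s))
      ≤ ∫ τ in s..t, ψ (L.V (y τ)) * (-L.Q (y τ) / 2 + χ L K D Θ B (Real.exp (z τ))) := by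
  have hVs : ContDiff ℝ 1 L.V := hA.smooth_V.of_le (by exact_mod_cast le_top)
  have hΨd : deriv Ψ = ψ := funext fun v => (hΨ v).deriv
  have hΨs : ContDiff ℝ 1 Ψ :=
    contDiff_one_iff_deriv.2 ⟨fun v => (hΨ v).differentiableAt, by rwa [hΨd]⟩
  have hcF := (locallyLipschitz_closedLoopField (K := K) hS hA hB hK.2.1.le).continuous
  have hcp : IsCompact (((fun τ => (y τ, z τ)) '' Icc 0 T) ×ˢ
      Metric.closedBall (0 : Vec q × Vec p × Vec m) M) :=
    (isCompact_Icc.image_of_continuousOn (h.cont_y.prodMk h.cont_z)).prod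
      (isCompact_closedBall _ _)
  obtain ⟨N, hN⟩ := hcp.exists_bound_of_continuousOn hcF.continuousOn
  have hbdd := hin.bdd
  have hdle := hin.d_le
  have hθle := hin.θ_le
  rw [ae_restrict_iff' measurableSet_Ici] at hbdd hdle hθle
  refine comp_sub_le_integral (W := fun y => Ψ (L.V y)) (M := N) (hΨs.comp hVs) h.integrable_y ?_
    h.eq_y h.cont_y ?_ ?_ hs hst ht
  · filter_upwards [hbdd] with τ h1 hm
    have := hN ((y τ, z τ), (d τ, θ τ, b τ)) ⟨⟨τ, hm, rfl⟩, by simpa using h1 hm.1⟩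
    exact (le_max_left _ _).trans this
  · refine (hψ.comp_continuousOn (h.cont_V hA)).mul (ContinuousOn.add ?_ ?_)
    · exact ((hA.smooth_Q.continuous.comp_continuousOn h.cont_y).neg).div_const 2
    · exact (continuous_χ_exp hK D Θ B).comp_continuousOn h.cont_z
  · filter_upwards [hdle, hθle] with τ h1 h2 hm
    have hfd : fderiv ℝ (fun y => Ψ (L.V y)) (y τ) = ψ (L.V (y τ)) • fderiv ℝ L.V (y τ) :=
      ((hΨ (L.V (y τ))).comp_hasFDerivAt (y τ)
        (hVs.differentiable one_ne_zero (y τ)).hasFDerivAt).fderiv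
    rw [hfd]
    simp only [smul_apply, smul_eq_mul]
    exact mul_le_mul_of_nonneg_left (lieD_plantField_le hA hB hK hin.B_pos (y τ) (z τ)
      (h1 hm.1) (h2 hm.1) (hin.b_ge τ hm.1)) (hψ0 _)

lemma IsSolutionOn.χ_le (h : IsSolutionOn S L K d θ b y₀ z₀ (Icc 0 T) y z)
    (hB : AssumptionB S L) (hK : K.Admissible) (hB0 : 0 < B) {τ : ℝ} (hτ : τ ∈ Icc 0 T) :
    χ L K D Θ B (Real.exp (z τ)) ≤ χ L K D Θ B (Real.exp z₀) := by
  refine χ_anti hB hK D Θ hB0 (Real.exp_pos _).le (Real.exp_le_exp.2 ?_)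
  rw [← h.z_zero (hτ.1.trans hτ.2)]
  exact h.z_mono hK.2.1.le le_rfl hτ.1 hτ.2

/-- The bound `G` is left free: `-a ∘ V` gives the stability estimate, and `0` gives the speed limit
on `V` used for the limit superior. -/
lemma IsSolutionOn.V_sub_le_integral (h : IsSolutionOn S L K d θ b y₀ z₀ (Icc 0 T) y z)
    (hS : S.Regular) (hA : AssumptionA S L) (hB : AssumptionB S L) (hK : K.Admissible)
    (hin : InputBounds d θ b D Θ B M) {G : ℝ → ℝ} (hG : ContinuousOn G (Icc 0 T))
    (hGQ : ∀ τ ∈ Icc 0 T, -L.Q (y τ) / 2 ≤ G τ)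
    {s t : ℝ} (hs : 0 ≤ s) (hst : s ≤ t) (ht : t ≤ T) :
    L.V (y t) - L.V (y s) ≤ ∫ τ in s..t, (G τ + χ L K D Θ B (Real.exp z₀)) := by
  have hsub : uIcc s t ⊆ Icc 0 T := by rw [uIcc_of_le hst]; exact Icc_subset_Icc hs ht
  refine (h.comp_V_sub_le hS hA hB hK hin (Ψ := id) (ψ := fun _ => 1) hasDerivAt_id
    continuous_const (fun _ => zero_le_one) hs hst ht).trans ?_
  refine intervalIntegral.integral_mono_on hst (ContinuousOn.intervalIntegrable ?_)
    (((hG.add continuousOn_const).mono hsub).intervalIntegrable) fun τ hτ => ?_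
  · refine (continuousOn_const.mul (ContinuousOn.add ?_ ?_)).mono hsub
    · exact ((hA.smooth_Q.continuous.comp_continuousOn h.cont_y).neg).div_const 2
    · exact (continuous_χ_exp hK D Θ B).comp_continuousOn h.cont_z
  · have hm : τ ∈ Icc 0 T := ⟨hs.trans hτ.1, hτ.2.trans ht⟩
    rw [one_mul]
    exact add_le_add (hGQ τ hm) (h.χ_le hB hK hin.B_pos hm)

/-- The practical stability estimate for `V`. -/
theorem IsSolutionOn.V_le (h : IsSolutionOn S L K d θ b y₀ z₀ (Icc 0 T) y z)
    (hS : S.Regular) (hA : AssumptionA S L) (hB : AssumptionB S L) (hK : K.Admissible)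
    (hin : InputBounds d θ b D Θ B M) {a ζ : ℝ → ℝ} {β : ℝ → ℝ → ℝ} (ha : IsClassK a)
    (haV : ∀ y, a (L.V y) ≤ L.Q y / 2)
    (hβ : ∀ s t, 0 ≤ s → 0 ≤ t → 0 ≤ β s t ∧ β s t + t * (a (β s t) / 2) = s)
    (hβc : IsClassKL β) (hζ : ∀ c, 0 ≤ c → 0 ≤ ζ c ∧ a (ζ c) / 2 = c) :
    ∀ t ∈ Icc 0 T, L.V (y t) ≤ β (L.V y₀) t + ζ (χ L K D Θ B (Real.exp z₀)) := by
  intro t ht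
  have hχ := χ_nonneg (L := L) hB hK D Θ hin.B_pos (Real.exp_pos z₀).le
  obtain ⟨hk, hak⟩ := hζ _ hχ
  have hV0 : ∀ τ ∈ Icc 0 T, 0 ≤ L.V (y τ) := fun τ _ => hA.posDef_V.nonneg _
  have := le_classKL_add_of_sub_le_integral (v := fun τ => L.V (y τ)) ha hβ hβc hk
    (c := χ L K D Θ B (Real.exp z₀)) (T := T) (by linarith) hV0 (h.cont_V hA)
    (fun s t hs hst ht => h.V_sub_le_integral hS hA hB hK hin (G := fun τ => -a (L.V (y τ)))
      (ha.1.comp (h.cont_V hA) hV0).neg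
      (fun τ _ => by
        linarith [haV (y τ)]) hs hst ht) t ht
  rwa [h.y_zero (ht.1.trans ht.2)] at this

/-- Squaring makes the positive part continuously differentiable, as the chain rule for `Ψ ∘ V`
requires. -/
lemma hasDerivAt_sq_max_div_two (ε v : ℝ) :
    HasDerivAt (fun v => (max (v - ε) 0) ^ 2 / 2) (max (v - ε) 0) v := by
  rcases lt_trichotomy v ε with hv | rfl | hv
  · rw [max_eq_right (by linarith)]
    refine (hasDerivAt_const v (0 : ℝ)).congr_of_eventuallyEq ?_
    filter_upwards [eventually_lt_nhds hv] with x hx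
    rw [max_eq_right (by linarith)]; simp
  · rw [sub_self, max_self, hasDerivAt_iff_isLittleO]
    simp only [sub_self, max_self, smul_zero, sub_zero, ne_eq, OfNat.ofNat_ne_zero,
      not_false_eq_true, zero_pow, zero_div]
    have hO : (fun x => (max (x - v) 0) ^ 2 / 2) =O[𝓝 v] fun x => (x - v) ^ 2 :=
      Asymptotics.IsBigO.of_bound 1 (Eventually.of_forall fun x => by
        rw [Real.norm_of_nonneg (by positivity), Real.norm_of_nonneg (by positivity), one_mul]
        rcases le_total 0 (x - v) with h | h
        · rw [max_eq_left h]; nlinarith [sq_nonneg (x - v)]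
        · rw [max_eq_right h]; nlinarith [sq_nonneg (x - v)])
    refine hO.trans_isLittleO ?_
    have := (Asymptotics.isLittleO_pow_id (𝕜 := ℝ) one_lt_two).comp_tendsto
      (show Tendsto (fun x => x - v) (𝓝 v) (𝓝 0) by
        have := (continuous_sub_right v).tendsto v
        rwa [sub_self] at this)
    exact this
  · rw [max_eq_left (by linarith)]
    have h1 : HasDerivAt (fun v => (v - ε) ^ 2 / 2) (v - ε) v := by
      have := (((hasDerivAt_id v).sub_const ε).pow 2).div_const 2
      simpa using this
    refine h1.congr_of_eventuallyEq ?_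
    filter_upwards [eventually_gt_nhds hv] with x hx
    rw [max_eq_left (by linarith)]

/-- The bound on the adaptation variable. -/
theorem IsSolutionOn.z_le (h : IsSolutionOn S L K d θ b y₀ z₀ (Icc 0 T) y z)
    (hS : S.Regular) (hA : AssumptionA S L) (hB : AssumptionB S L) (hK : K.Admissible)
    (hin : InputBounds d θ b D Θ B M) {a : ℝ → ℝ} {v : ℝ} (ha : IsClassK a)
    (haV : ∀ y, a (L.V y) ≤ L.Q y / 2) (hv : ∀ t ∈ Icc 0 T, L.V (y t) ≤ v) :
    ∀ t ∈ Icc 0 T, z t ≤ max z₀ (Real.log (2 * K.κ * χ L K D Θ B 0 / a K.ε + 1))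
      + K.Γ * Real.exp (-z₀) * v ^ 2 / a K.ε := by
  intro t ht
  have hε := hK.1
  have hΓ := hK.2.1
  have hκ := hK.2.2.2.1
  have hT : 0 ≤ T := ht.1.trans ht.2
  have haε : 0 < a K.ε := ha.pos hε
  have hχ0 : 0 ≤ χ L K D Θ B 0 := χ_nonneg hB hK D Θ hin.B_pos le_rfl
  -- Beyond this level, monotonicity of `(κ+s₄)χ` gives `χ ≤ a(ε)/2`. The `+ 1` keeps the
  -- logarithm's argument positive.
  set z₁ := max z₀ (Real.log (2 * K.κ * χ L K D Θ B 0 / a K.ε + 1)) with hz₁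
  have hlast : 0 ≤ K.Γ * Real.exp (-z₀) * v ^ 2 / a K.ε := by positivity
  rcases le_total (z t) z₁ with hzt | hzt
  · linarith
  have hsub0 : Icc 0 t ⊆ Icc 0 T := Icc_subset_Icc le_rfl ht.2
  obtain ⟨t₁, ht₁, hzt₁⟩ := intermediate_value_Icc ht.1 (h.cont_z.mono hsub0)
    ⟨by rw [h.z_zero hT]; exact le_max_left _ _, hzt⟩
  have hsub : Icc t₁ t ⊆ Icc 0 T := Icc_subset_Icc ht₁.1 ht.2
  have husub : uIcc t₁ t ⊆ Icc 0 T := by rwa [uIcc_of_le ht₁.2]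
  have hχle : ∀ τ ∈ Icc t₁ t, χ L K D Θ B (Real.exp (z τ)) ≤ a K.ε / 2 := by
    intro τ hτ
    have h1 : z₁ ≤ z τ := by
      rw [← hzt₁]; exact h.z_mono hΓ.le ht₁.1 hτ.1 (hτ.2.trans ht.2)
    have h2 : 2 * K.κ * χ L K D Θ B 0 / a K.ε + 1 ≤ Real.exp (z τ) := by
      rw [← Real.log_le_iff_le_exp (by positivity)]
      exact (le_max_right _ _).trans h1
    have h3 := χ_le_mul_χ_div (L := L) hK D Θ hin.B_pos le_rfl (Real.exp_pos (z τ)).le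
    refine h3.trans ?_
    rw [add_zero, div_le_iff₀ (by positivity)]
    have h4 : 2 * K.κ * χ L K D Θ B 0 / a K.ε ≤ K.κ + Real.exp (z τ) := by linarith
    rw [div_le_iff₀ haε] at h4
    linarith
  have hpc : ContinuousOn (fun τ => max (L.V (y τ) - K.ε) 0) (Icc 0 T) :=
    ((h.cont_V hA).sub continuousOn_const).sup continuousOn_const
  have hpi : IntervalIntegrable (fun τ => max (L.V (y τ) - K.ε) 0) volume t₁ t :=
    (hpc.mono husub).intervalIntegrable
  have hdecr := h.comp_V_sub_le hS hA hB hK hin (hasDerivAt_sq_max_div_two K.ε) (by fun_prop)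
    (fun _ => le_max_right _ _) ht₁.1 ht₁.2 ht.2
  have hupper : ∫ τ in t₁..t, max (L.V (y τ) - K.ε) 0 *
        (-L.Q (y τ) / 2 + χ L K D Θ B (Real.exp (z τ)))
      ≤ ∫ τ in t₁..t, max (L.V (y τ) - K.ε) 0 * (-(a K.ε / 2)) := by
    refine intervalIntegral.integral_mono_on ht₁.2 (ContinuousOn.intervalIntegrable ?_)
      (hpi.mul_const _) fun τ hτ => ?_
    · refine (hpc.mul (ContinuousOn.add ?_ ?_)).mono husub
      · exact ((hA.smooth_Q.continuous.comp_continuousOn h.cont_y).neg).div_const 2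
      · exact (continuous_χ_exp hK D Θ B).comp_continuousOn h.cont_z
    · rcases le_total (L.V (y τ)) K.ε with hle | hle
      · rw [max_eq_right (by linarith)]; simp
      · refine mul_le_mul_of_nonneg_left ?_ (le_max_right _ _)
        have h1 := haV (y τ)
        have h2 := ha.2.1.monotoneOn hε.le (hε.le.trans hle) hle
        linarith [hχle τ hτ]
  rw [intervalIntegral.integral_mul_const] at hupper
  have hV1 := hv t₁ (hsub ⟨le_rfl, ht₁.2⟩)
  have hV1' := hA.posDef_V.nonneg (y t₁)
  have hmax : max (L.V (y t₁) - K.ε) 0 ≤ v := max_le (by linarith) (by linarith)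
  have hsq : (max (L.V (y t₁) - K.ε) 0) ^ 2 ≤ v ^ 2 := by gcongr
  -- The function `((V-ε)⁺)²/2` starts at most at `v²/2`, stays nonnegative and loses at least
  -- `(a(ε)/2)(V-ε)⁺` per unit time.
  have hI : (∫ τ in t₁..t, max (L.V (y τ) - K.ε) 0) ≤ v ^ 2 / a K.ε := by
    rw [le_div_iff₀ haε]
    have : 0 ≤ (max (L.V (y t) - K.ε) 0) ^ 2 := by positivity
    linarith
  have hz := h.z_sub_eq ht₁.1 ht₁.2 ht.2
  have hzle : ∫ τ in t₁..t, adaptField L K (y τ) (z τ)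
      ≤ ∫ τ in t₁..t, K.Γ * Real.exp (-z₀) * max (L.V (y τ) - K.ε) 0 := by
    refine intervalIntegral.integral_mono_on ht₁.2
      (((h.cont_adapt hA).mono husub).intervalIntegrable) (hpi.const_mul _) fun τ hτ => ?_
    unfold adaptField
    have : z₀ ≤ z τ := by
      rw [← h.z_zero hT]
      exact h.z_mono hΓ.le le_rfl (ht₁.1.trans hτ.1) (hτ.2.trans ht.2)
    gcongr
  rw [intervalIntegral.integral_const_mul] at hzle
  have : K.Γ * Real.exp (-z₀) * (∫ τ in t₁..t, max (L.V (y τ) - K.ε) 0)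
      ≤ K.Γ * Real.exp (-z₀) * (v ^ 2 / a K.ε) := by gcongr
  rw [← mul_div_assoc] at this
  linarith

end APriori

/-! ### The limit superior of `V` -/

section Asymptotics

variable {n m p q : ℕ} {S : Plant n m p q} {L : LyapData n m} {K : Gains}
  {d : ℝ → Vec q} {θ : ℝ → Vec p} {b : ℝ → Vec m} {D Θ B M : ℝ}
  {y₀ : Vec n} {z₀ : ℝ} {y : ℝ → Vec n} {z : ℝ → ℝ}

/-- Convergence of the adaptation variable forces `limsup V ≤ ε`. -/
theorem IsSolutionOn.eventually_V_le (h : IsSolutionOn S L K d θ b y₀ z₀ (Ici 0) y z)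
    (hS : S.Regular) (hA : AssumptionA S L) (hB : AssumptionB S L) (hK : K.Admissible)
    (hin : InputBounds d θ b D Θ B M) {zlim : ℝ} (hz : Tendsto z atTop (𝓝 zlim))
    (hzle : ∀ t, 0 ≤ t → z t ≤ zlim) {η : ℝ} (hη : 0 < η) :
    ∀ᶠ t in atTop, L.V (y t) ≤ K.ε + η := by
  have hΓ := hK.2.1
  have hχ := χ_nonneg (L := L) hB hK D Θ hin.B_pos (Real.exp_pos z₀).le
  set c := χ L K D Θ B (Real.exp z₀) + 1 with hc
  have hcpos : 0 < c := by positivity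
  -- As `V` rises at speed at most `c`, `V(t) > ε + η` forces `V ≥ ε + η/2` on `[t - l, t]`. There
  -- `z` gains at least `e`, contradicting `z(t) - z(t - l) → 0`.
  set l := η / (2 * c) with hl
  have hlpos : 0 < l := by positivity
  set e := l * (K.Γ * Real.exp (-zlim) * (η / 2)) with he
  have hepos : 0 < e := by positivity
  have hdiff : Tendsto (fun t => z t - z (t - l)) atTop (𝓝 (zlim - zlim)) :=
    hz.sub (hz.comp (tendsto_atTop_add_const_right _ (-l) tendsto_id))
  rw [sub_self] at hdiff
  filter_upwards [hdiff.eventually_lt_const hepos, eventually_ge_atTop l] with t hlt htl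
  by_contra! hV
  have hT := h.mono (J := Icc 0 t) Icc_subset_Ici_self
  have h0 : 0 ≤ t - l := by linarith
  have hlow : ∀ τ ∈ Icc (t - l) t, K.ε + η / 2 ≤ L.V (y τ) := by
    intro τ hτ
    have h1 := hT.V_sub_le_integral hS hA hB hK hin (G := fun _ => 0) continuousOn_const
      (fun τ _ => by linarith [hA.posDef_Q.nonneg (y τ)]) (h0.trans hτ.1) hτ.2 le_rfl
    rw [intervalIntegral.integral_const, smul_eq_mul, zero_add] at h1
    have h2 : (t - τ) * χ L K D Θ B (Real.exp z₀) ≤ l * c := by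
      have : t - τ ≤ l := by linarith [hτ.1]
      gcongr
      linarith
    have h3 : l * c = η / 2 := by rw [hl]; field_simp
    linarith
  have hz1 := hT.z_sub_eq h0 (by linarith) le_rfl
  have hsub : uIcc (t - l) t ⊆ Icc 0 t := by
    rw [uIcc_of_le (by linarith)]; exact Icc_subset_Icc h0 le_rfl
  have hz2 : ∫ _τ in (t - l)..t, K.Γ * Real.exp (-zlim) * (η / 2)
      ≤ ∫ τ in (t - l)..t, adaptField L K (y τ) (z τ) := by
    refine intervalIntegral.integral_mono_on (by linarith) (by simp)
      (((hT.cont_adapt hA).mono hsub).intervalIntegrable) fun τ hτ => ?_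
    unfold adaptField
    have h1 := hzle τ (h0.trans hτ.1)
    have h2 : η / 2 ≤ max (L.V (y τ) - K.ε) 0 :=
      le_max_of_le_left (by linarith [hlow τ hτ])
    gcongr
  rw [intervalIntegral.integral_const, smul_eq_mul, sub_sub_cancel, ← hz1] at hz2
  linarith

end Asymptotics

/-! ### Essential bounds of the inputs -/

section Inputs

lemma EssBounded.ae_norm_le {k : ℕ} {w : ℝ → Vec k} (hw : EssBounded w) :
    ∀ᵐ t ∂(volume.restrict (Ici (0 : ℝ))), ‖w t‖ ≤ supNorm w := by
  have h1 : ∀ᵐ t ∂halfLine, ‖w t‖ₑ ≤ eLpNormEssSup w halfLine := enorm_ae_le_eLpNormEssSup w _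
  have hfin : eLpNorm w ⊤ halfLine ≠ ⊤ := hw.2.ne
  filter_upwards [h1] with t ht
  rw [← eLpNorm_exponent_top] at ht
  have := ENNReal.toReal_mono hfin ht
  simpa [supNorm] using this

lemma minInf_le {m : ℕ} {b : ℝ → Vec m} (hb : ∀ t, 0 ≤ t → ∀ i, 0 < b t i) {t : ℝ} (ht : 0 ≤ t)
    (i : Fin m) : minInf b ≤ b t i :=
  (ciInf_le (finite_range _).bddBelow i).trans
    (ciInf_le ⟨0, by rintro _ ⟨s, rfl⟩; exact (hb s s.2 i).le⟩ (⟨t, ht⟩ : Ici (0 : ℝ)))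

lemma minInf_pos {m : ℕ} (hm : 0 < m) {b : ℝ → Vec m}
    (hb : ∀ i, 0 < ⨅ t : Ici (0 : ℝ), b t i) : 0 < minInf b := by
  have : Nonempty (Fin m) := ⟨⟨0, hm⟩⟩
  obtain ⟨i, hi⟩ := exists_eq_ciInf_of_finite (f := fun i : Fin m => ⨅ t : Ici (0 : ℝ), b t i)
  rw [minInf, ← hi]
  exact hb i

lemma inputBounds_of_essBounded {m p q : ℕ} (hm : 0 < m) {d : ℝ → Vec q} {θ : ℝ → Vec p}
    {b : ℝ → Vec m} (hd : EssBounded d) (hθ : EssBounded θ) (hb : EssBounded b)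
    (hb0 : ∀ t, 0 ≤ t → ∀ i, 0 < b t i) (hbi : ∀ i, 0 < ⨅ t : Ici (0 : ℝ), b t i) :
    InputBounds d θ b (supNorm d) (supNorm θ) (minInf b)
      (max (supNorm d) (max (supNorm θ) (supNorm b))) where
  meas := hd.1.prodMk (hθ.1.prodMk hb.1)
  bdd := by
    filter_upwards [hd.ae_norm_le, hθ.ae_norm_le, hb.ae_norm_le] with t h1 h2 h3
    exact max_le_max h1 (max_le_max h2 h3)
  d_le := hd.ae_norm_le
  θ_le := hθ.ae_norm_le
  B_pos := minInf_pos hm hbi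
  b_ge := fun t ht i => minInf_le hb0 ht i

end Inputs

/-! ### Choice of the comparison functions and conclusion -/

lemma IsClassK.half {a : ℝ → ℝ} (ha : IsClassK a) : IsClassK (fun x => a x / 2) :=
  ⟨ha.1.div_const 2, fun x hx y hy hxy => by
    have := ha.2.1 hx hy hxy
    change a x / 2 < a y / 2
    linarith, by simp [ha.2.2]⟩

lemma IsClassKInf.half {a : ℝ → ℝ} (ha : IsClassKInf a) : IsClassKInf (fun x => a x / 2) :=
  ⟨ha.1.half, ha.2.atTop_div_const two_pos⟩

/-- The last slot is a free function because `R` contains `χ` both at `e^{z₀}` and at `0`. -/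
lemma continuousOn_χ {n m : ℕ} {L : LyapData n m} {K : Gains} (hK : K.Admissible)
    {s : Vec n × ℝ × ℝ × ℝ × ℝ → ℝ} (hs : Continuous s) (hs0 : ∀ x, 0 ≤ s x) :
    ContinuousOn (fun x : Vec n × ℝ × ℝ × ℝ × ℝ =>
      χ L K x.2.2.1 x.2.2.2.1 x.2.2.2.2 (s x))
      {x | 0 ≤ x.2.2.1 ∧ 0 ≤ x.2.2.2.1 ∧ 0 < x.2.2.2.2} := by
  obtain ⟨-, -, hC, hκ, -⟩ := hK
  have hinv : ContinuousOn (fun x : Vec n × ℝ × ℝ × ℝ × ℝ => 1 / x.2.2.2.2)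
      {x | 0 ≤ x.2.2.1 ∧ 0 ≤ x.2.2.2.1 ∧ 0 < x.2.2.2.2} :=
    continuousOn_const.div (by fun_prop) fun x hx => hx.2.2.ne'
  unfold χ
  refine ContinuousOn.div ?_ (by fun_prop) fun x _ => ?_
  · refine ContinuousOn.add (by fun_prop) (ContinuousOn.mul (by fun_prop) (ContinuousOn.pow ?_ 2))
    exact ((hinv.sub continuousOn_const).sub hs.continuousOn).sup continuousOn_const
  · have := hs0 x
    positivity

end DADS

end

open DADS

theorem theorem1 {n m p q : ℕ} (hm : 0 < m)
    (S : DADS.Plant n m p q) (hS : S.Regular)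
    (L : DADS.LyapData n m) (hA : DADS.AssumptionA S L) (hB : DADS.AssumptionB S L)
    (K : DADS.Gains) (hK : K.Admissible) :
    ∃ (β : ℝ → ℝ → ℝ) (ζ : ℝ → ℝ) (R : DADS.Vec n × ℝ × ℝ × ℝ × ℝ → ℝ),
      DADS.IsClassKL β ∧ DADS.IsClassKInf ζ ∧
      ContinuousOn R {x | 0 ≤ x.2.2.1 ∧ 0 ≤ x.2.2.2.1 ∧ 0 < x.2.2.2.2} ∧
      ∀ (y₀ : DADS.Vec n) (z₀ : ℝ)
        (d : ℝ → DADS.Vec q) (θ : ℝ → DADS.Vec p) (b : ℝ → DADS.Vec m),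
        DADS.EssBounded d → DADS.EssBounded θ → DADS.EssBounded b →
        (∀ t, 0 ≤ t → ∀ i, 0 < b t i) →
        (∀ i, 0 < ⨅ t : Ici (0 : ℝ), b t i) →
        ∃ (y : ℝ → DADS.Vec n) (z : ℝ → ℝ),
          -- a global solution exists
          DADS.IsSolutionOn S L K d θ b y₀ z₀ (Ici 0) y z ∧
          -- every solution on some `[0, T)` is its restriction
          (∀ (T : ℝ) (y' : ℝ → DADS.Vec n) (z' : ℝ → ℝ),
            DADS.IsSolutionOn S L K d θ b y₀ z₀ (Ico 0 T) y' z' →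
            EqOn y' y (Ico 0 T) ∧ EqOn z' z (Ico 0 T)) ∧
          -- the limit superior is taken in the extended reals
          limsup (fun t => ((L.V (y t) : ℝ) : EReal)) atTop ≤ ((K.ε : ℝ) : EReal) ∧
          (∀ t, 0 ≤ t → L.V (y t) ≤ β (L.V y₀) t
            + ζ (DADS.χ L K (DADS.supNorm d) (DADS.supNorm θ) (DADS.minInf b)
                (Real.exp z₀))) ∧
          MonotoneOn z (Ici 0) ∧
          ∃ zlim : ℝ, Tendsto z atTop (𝓝 zlim) ∧
            (∀ t, 0 ≤ t → z₀ ≤ z t ∧ z t ≤ zlim) ∧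
            zlim ≤ R (y₀, z₀, DADS.supNorm d, DADS.supNorm θ, DADS.minInf b) := by
  have hVs := hA.smooth_V.continuous
  have hε := hK.1
  obtain ⟨a, haI, haV⟩ := exists_isClassKInf_comp_le (V := L.V) (Q := fun y => L.Q y / 2)
    hVs (hA.smooth_Q.continuous.div_const 2) hA.posDef_V
    ⟨by simp [hA.posDef_Q.1], fun x hx => half_pos (hA.posDef_Q.2 x hx)⟩
    (fun N hN => by
      convert hA.radial_Q (2 * N) (by positivity) using 3 with x
      rw [div_le_iff₀ two_pos, mul_comm])
  have ha := haI.1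
  -- Half of `a` must dominate the disturbance, so `ζ` inverts `a/2`; the other half drives the
  -- decay, so `β` solves `r + t a(r)/2 = s`.
  choose! ζ hζ using fun c (hc : (0 : ℝ) ≤ c) => haI.half.exists_eq hc
  choose! β hβ using fun (s t : ℝ) (hs : 0 ≤ s) (ht : 0 ≤ t) =>
    (ha.half.isClassKInf_id_add_mul ht).exists_eq hs
  have hβc : IsClassKL β := ha.half.isClassKL_of_add_mul_eq hβ
  have hζc : IsClassKInf ζ := haI.half.inverse hζ
  have haε : 0 < a K.ε := ha.pos hε
  let vmax : Vec n × ℝ × ℝ × ℝ × ℝ → ℝ := fun x =>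
    β (L.V x.1) 0 + ζ (χ L K x.2.2.1 x.2.2.2.1 x.2.2.2.2 (Real.exp x.2.1))
  let R : Vec n × ℝ × ℝ × ℝ × ℝ → ℝ := fun x =>
    max x.2.1 (Real.log (2 * K.κ * χ L K x.2.2.1 x.2.2.2.1 x.2.2.2.2 0 / a K.ε + 1))
      + K.Γ * Real.exp (-x.2.1) * vmax x ^ 2 / a K.ε
  have hκ := hK.2.2.2.1
  refine ⟨β, ζ, R, hβc, hζc, ?_, ?_⟩
  · have hvc : ContinuousOn vmax {x | 0 ≤ x.2.2.1 ∧ 0 ≤ x.2.2.2.1 ∧ 0 < x.2.2.2.2} := by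
      refine ContinuousOn.add ?_ ?_
      · exact ((hβc.2.1 0 le_rfl).1.comp_continuous (hVs.comp continuous_fst)
          fun x => hA.posDef_V.nonneg x.1).continuousOn
      · exact hζc.1.1.comp (continuousOn_χ hK (by fun_prop) fun x => (Real.exp_pos _).le)
          fun x hx => χ_nonneg hB hK _ _ hx.2.2 (Real.exp_pos _).le
    have hlog : ContinuousOn (fun x : Vec n × ℝ × ℝ × ℝ × ℝ =>
        Real.log (2 * K.κ * χ L K x.2.2.1 x.2.2.2.1 x.2.2.2.2 0 / a K.ε + 1))
        {x | 0 ≤ x.2.2.1 ∧ 0 ≤ x.2.2.2.1 ∧ 0 < x.2.2.2.2} := by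
      refine ContinuousOn.log (((continuousOn_const.mul
        (continuousOn_χ hK continuous_const fun _ => le_rfl)).div_const _).add
          continuousOn_const) fun x hx => ?_
      have := χ_nonneg (L := L) hB hK x.2.2.1 x.2.2.2.1 hx.2.2 le_rfl
      positivity
    refine ContinuousOn.add ?_ ?_
    · exact (by fun_prop : Continuous fun x : Vec n × ℝ × ℝ × ℝ × ℝ => x.2.1).continuousOn.sup hlog
    · exact ((by fun_prop : Continuous fun x : Vec n × ℝ × ℝ × ℝ × ℝ =>
        K.Γ * Real.exp (-x.2.1)).continuousOn.mul (hvc.pow 2)).div_const _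
  intro y₀ z₀ d θ b hd hθ hb hb0 hbi
  have hin := inputBounds_of_essBounded hm hd hθ hb hb0 hbi
  set D := supNorm d
  set Θ := supNorm θ
  set B := minInf b
  set M := max D (max Θ (supNorm b))
  set v := vmax (y₀, z₀, D, Θ, B) with hv
  set Z := R (y₀, z₀, D, Θ, B) with hZ
  have hVle : ∀ (T : ℝ) (y : ℝ → Vec n) (z : ℝ → ℝ),
      IsSolutionOn S L K d θ b y₀ z₀ (Icc 0 T) y z → ∀ t ∈ Icc 0 T,
      L.V (y t) ≤ β (L.V y₀) t + ζ (χ L K D Θ B (Real.exp z₀)) := fun T y z h =>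
    h.V_le hS hA hB hK hin ha haV hβ hβc hζ
  have hVv : ∀ (T : ℝ) (y : ℝ → Vec n) (z : ℝ → ℝ),
      IsSolutionOn S L K d θ b y₀ z₀ (Icc 0 T) y z → ∀ t ∈ Icc 0 T, L.V (y t) ≤ v := by
    intro T y z h t ht
    have h1 := (hβc.2.2 (L.V y₀) (hA.posDef_V.nonneg _)).1 (self_mem_Ici (a := (0 : ℝ))) ht.1 ht.1
    have h2 := hVle T y z h t ht
    simp only [hv, vmax]
    linarith
  have hzZ : ∀ (T : ℝ) (y : ℝ → Vec n) (z : ℝ → ℝ),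
      IsSolutionOn S L K d θ b y₀ z₀ (Icc 0 T) y z → ∀ t ∈ Icc 0 T, z t ≤ Z := fun T y z h =>
    h.z_le hS hA hB hK hin ha haV (hVv T y z h)
  have hzz : ∀ (T : ℝ) (y : ℝ → Vec n) (z : ℝ → ℝ),
      IsSolutionOn S L K d θ b y₀ z₀ (Icc 0 T) y z → ∀ t ∈ Icc 0 T, z₀ ≤ z t := by
    intro T y z h t ht
    rw [← h.z_zero (ht.1.trans ht.2)]
    exact h.z_mono hK.2.1.le le_rfl ht.1 ht.2
  -- Radial unboundedness is stated for positive levels only, hence `max v 1`.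
  obtain ⟨Y, hY⟩ := (hA.radial_V (max v 1) (by positivity)).exists_bound_of_continuousOn
    continuousOn_id
  obtain ⟨x, hxc, hx0, hx, hxu⟩ := exists_global_isIntegralSol
    (locallyLipschitz_closedLoopField (K := K) hS hA hB hK.2.1.le) (M := max M 0)
    (ρ := max Y 0 + (|z₀| + |Z|) + 1) (le_max_right _ _) (by positivity) hin.meas
    (hin.bdd.mono fun t ht => ht.trans (le_max_left _ _)) (y₀, z₀) (by
      intro T x hx t ht
      have h := hx.isSolutionOn
      have h1 := hY _ ((hVv T _ _ h t ht).trans (le_max_left v 1))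
      have h2 := hzZ T _ _ h t ht
      have h3 := hzz T _ _ h t ht
      have h4 : ‖(x t).2‖ ≤ |z₀| + |Z| := by
        rw [Real.norm_eq_abs, abs_le]
        constructor <;>
          linarith [neg_abs_le z₀, le_abs_self Z, abs_nonneg z₀, abs_nonneg Z]
      have h5 := le_max_left Y 0
      have h6 := le_max_right Y 0
      simp only [id] at h1
      refine max_lt ?_ ?_
      · linarith [abs_nonneg z₀, abs_nonneg Z]
      · linarith)
  have hsol := hx.isSolutionOn
  have hsolT : ∀ T, IsSolutionOn S L K d θ b y₀ z₀ (Icc 0 T) (fun t => (x t).1)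
      (fun t => (x t).2) := fun T => hsol.mono Icc_subset_Ici_self
  -- The solution is extended by its initial value to negative times, so `z` is monotone on all of
  -- `ℝ` and converges to its supremum.
  have hmono : Monotone fun t => (x t).2 := by
    intro s t hst
    rcases le_total s 0 with hs | hs
    · rcases le_total t 0 with ht | ht
      · simp only [hx0 s hs, hx0 t ht, le_rfl]
      · simp only [hx0 s hs]
        exact hzz t _ _ (hsolT t) t ⟨ht, le_rfl⟩
    · exact (hsolT t).z_mono hK.2.1.le hs hst le_rfl
  have hbdd : BddAbove (range fun t => (x t).2) := by
    refine ⟨max z₀ Z, ?_⟩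
    rintro _ ⟨t, rfl⟩
    rcases le_total t 0 with ht | ht
    · simp only [hx0 t ht]; exact le_max_left _ _
    · exact (hzZ t _ _ (hsolT t) t ⟨ht, le_rfl⟩).trans (le_max_right _ _)
  have hlim := tendsto_atTop_ciSup hmono hbdd
  have hzlim : ∀ t, (x t).2 ≤ ⨆ t, (x t).2 := fun t => le_ciSup hbdd t
  refine ⟨fun t => (x t).1, fun t => (x t).2, hsol, ?_, ?_, ?_, hmono.monotoneOn _,
    ⨆ t, (x t).2, hlim, fun t ht => ⟨hzz t _ _ (hsolT t) t ⟨ht, le_rfl⟩, hzlim t⟩, ?_⟩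
  · intro T y' z' h'
    have := hxu T _ h'.isIntegralSol
    exact ⟨fun t ht => congrArg Prod.fst (this ht), fun t ht => congrArg Prod.snd (this ht)⟩
  · refine EReal.le_of_forall_lt_iff_le.1 fun c hc => ?_
    have hη : 0 < c - K.ε := sub_pos.2 (by exact_mod_cast hc)
    refine limsup_le_of_le (by isBoundedDefault) ?_
    filter_upwards [hsol.eventually_V_le hS hA hB hK hin hlim (fun t _ => hzlim t) hη] with t ht
    rw [add_sub_cancel] at ht
    exact_mod_cast ht
  · exact fun t ht => hVle t _ _ (hsolT t) t ⟨ht, le_rfl⟩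
  · refine le_of_tendsto hlim ?_
    filter_upwards [eventually_ge_atTop 0] with t ht
    exact hzZ t _ _ (hsolT t) t ⟨ht, le_rfl⟩
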